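/- Let $K$ be a function field in one variable over a finite field $\mathbb{F}_q$ (the function field of a nonsingular projective curve $X$ over $\mathbb{F}_q$), let $\infty$ be a closed point of $X$ (a place of $K$), and let $A \subset K$ be the ring of regular functions on $X \setminus \{\infty\}$, whose fraction field is $K$. Let $L$ be a finite extension of $K$, with the inclusion $A \to L$. Let $L\{\tau\}$ be the ring of polynomials $\sum_i c_i x^{q^i} \in L[x]$ under addition and composition. A Drinfeld $A$-module over $L$ is an $\mathbb{F}_q$-algebra homomorphism $\phi : A \to L\{\tau\}$, $a \mapsto \phi_a$, such that $\phi_a$ has linear coefficient $a$ for every $a \in A$ and $\phi_a \neq ax$ for some $a$. It has rank $1$ if $\deg_x \phi_a = \#(A/aA)$ for every nonzero $a \in A$. Two Drinfeld $A$-modules $\phi, \psi$ over $L$ are isomorphic over $L$ if there is $u \in L^\ast$ with $u\,\phi_a(x) = \psi_a(u x)$ for all $a \in A$. Put $$({}^\phi L)_{\mathrm{tors}} = \{\alpha \in L : \phi_a(\alpha) = 0 \text{ for some nonzero } a \in A\}.$$ Theorem. For fixed $A$ and fixed finite extension $L$ of $K$, there are, up to isomorphism over $L$, at most finitely many rank $1$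 Drinfeld $A$-modules $\phi$ over $L$ for which $({}^\phi L)_{\mathrm{tors}} \neq 0$. -/

import Mathlib

open Polynomial

noncomputable section

/-- A place of the field `K` over the constant field `F`: a valuation subring of `K` that contains
`F` and is not all of `K`. When `K` is a function field in one variable over `F`, these are the
local rings of the closed points of the nonsingular projective curve over `F` with function
field `K`, so that places and closed points correspond. -/
@[ext]
structure FunctionFieldPlace (F K : Type*) [Field F] [Field K] [Algebra F K] where
  /-- The local ring at the closed point. -/
  ring : ValuationSubring K
  algebraMap_mem : ∀ c : F, algebraMap F K c ∈ ring
  ne_top : ring ≠ ⊤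

/-- The ring of regular functions on the curve with the closed point `P` removed: the elements of
the function field that lie in the local ring at every closed point other than `P`. -/
def FunctionFieldPlace.regularAway {F K : Type*} [Field F] [Field K] [Algebra F K]
    (P : FunctionFieldPlace F K) : Subalgebra F K where
  carrier := {x | ∀ Q : FunctionFieldPlace F K, Q ≠ P → x ∈ Q.ring}
  mul_mem' hx hy Q hQ := Q.ring.mul_mem _ _ (hx Q hQ) (hy Q hQ)
  add_mem' hx hy Q hQ := Q.ring.add_mem _ _ (hx Q hQ) (hy Q hQ)
  algebraMap_mem' c Q _ := Q.algebraMap_mem c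

/-- A Drinfeld `A`-module over the `A`-field `L`, where `A` is an algebra over the finite field `F`
with `q` elements. The twisted polynomial ring `L{τ}` is represented by the polynomials
`∑ cᵢ X ^ (q ^ i)` over `L`, with composition as multiplication; a Drinfeld module is an `F`-algebra
homomorphism `a ↦ φ_a` from `A` to this ring such that the linear coefficient of `φ_a` is the image
of `a` in `L`, and which is not just `a ↦ a X`. -/
@[ext]
structure DrinfeldModule (F A L : Type*) [Field F] [Finite F] [CommRing A] [Algebra F A]
    [Field L] [Algebra A L] where
  /-- The polynomial `φ_a`. -/
  poly : A → L[X]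
  support_poly : ∀ (a : A) (n : ℕ), n ∈ (poly a).support → ∃ i : ℕ, n = Nat.card F ^ i
  poly_algebraMap : ∀ c : F, poly (algebraMap F A c) = C (algebraMap A L (algebraMap F A c)) * X
  poly_add : ∀ a b : A, poly (a + b) = poly a + poly b
  poly_mul : ∀ a b : A, poly (a * b) = (poly a).comp (poly b)
  coeff_one_poly : ∀ a : A, (poly a).coeff 1 = algebraMap A L a
  nontrivial : ∃ a : A, poly a ≠ C (algebraMap A L a) * X

namespace DrinfeldModule

variable {F A L : Type*} [Field F] [Finite F] [CommRing A] [Algebra F A] [Field L] [Algebra A L]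

/-- `φ` has rank `r` if `deg φ_a = |a| ^ r`, where `|a| = #(A / aA)`, for every nonzero `a`. (The
degree is that of `φ_a` as a polynomial in `X`, so `φ_a` has `τ`-degree `r * log_q |a|`.) -/
def HasRank (φ : DrinfeldModule F A L) (r : ℕ) : Prop :=
  ∀ a : A, a ≠ 0 → (φ.poly a).natDegree = Nat.card (A ⧸ Ideal.span {a}) ^ r

/-- The `L`-rational torsion: all `α` in `L` killed by `φ_a` for some nonzero `a`. -/
def torsion (φ : DrinfeldModule F A L) : Set L :=
  {α | ∃ a : A, a ≠ 0 ∧ (φ.poly a).eval α = 0}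

/-- Isomorphism over `L`: there is a unit `u` of the twisted polynomial ring, that is, `u` in `Lˣ`,
with `u φ_a = ψ_a u` for all `a`. -/
def IsIso (φ ψ : DrinfeldModule F A L) : Prop :=
  ∃ u : Lˣ, ∀ a : A, (C (u : L) * X).comp (φ.poly a) = (ψ.poly a).comp (C (u : L) * X)

/-- Drinfeld modules over `L` up to isomorphism over `L`. -/
instance isoSetoid (F A L : Type*) [Field F] [Finite F] [CommRing A] [Algebra F A]
    [Field L] [Algebra A L] : Setoid (DrinfeldModule F A L) where
  r := IsIso
  iseqv :=
    { refl := fun φ => ⟨1, fun a => by simp⟩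
      symm := by
        rintro φ ψ ⟨u, hu⟩
        have h1 : (C (u : L) * X).comp (C ((u⁻¹ : Lˣ) : L) * X) = X := by
          simp [← mul_assoc, ← C_mul]
        have h2 : (C ((u⁻¹ : Lˣ) : L) * X).comp (C (u : L) * X) = X := by
          simp [← mul_assoc, ← C_mul]
        refine ⟨u⁻¹, fun a => ?_⟩
        calc (C ((u⁻¹ : Lˣ) : L) * X).comp (ψ.poly a)
            = ((C ((u⁻¹ : Lˣ) : L) * X).comp
                ((ψ.poly a).comp (C (u : L) * X))).comp (C ((u⁻¹ : Lˣ) : L) * X) := by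
              rw [comp_assoc, comp_assoc, h1, comp_X]
          _ = (φ.poly a).comp (C ((u⁻¹ : Lˣ) : L) * X) := by
              rw [← hu a, ← comp_assoc, h2, X_comp]
      trans := by
        rintro φ ψ χ ⟨u, hu⟩ ⟨v, hv⟩
        have h : C ((v * u : Lˣ) : L) * X = (C (v : L) * X).comp (C (u : L) * X) := by
          simp [mul_assoc]
        refine ⟨v * u, fun a => ?_⟩
        rw [h, comp_assoc, hu a, ← comp_assoc, hv a, comp_assoc] }

end DrinfeldModule

end

open Polynomial

noncomputable section

/-! Take `t` in `A` with `D = #(A/tA) > 1`, and let `E` be an algebraic closure of `L`. A rank 1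
module `φ` over `L` is rescaled over `E` to `ρ = u⁻¹ φ u` with `ρ_t` monic, where `u ^ (D - 1)` is
the inverse of the leading coefficient `l` of `φ_t`. Three facts then give the theorem.

Only finitely many normalized `ρ` exist (`finite_setOf_monic`). An action in generic characteristic
that is not purely scalar has rank at least 1 (`le_natDegree_of_card_eq`), so a rank 1 action cannot
lose degree under reduction and has potentially good reduction at every valuation trivial on `A`
(`coeff_mem_valuationSubring`). An infinite family of normalized actions would produce, over an
ultraproduct of the base field, a normalized action with a coefficient outside that field, hence
non-integral at some valuation trivial on it.

For one fixed `ρ`, torsion points of prime order whose multiples have bounded degree over `F(t)`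
have only finitely many orders (`finite_setOf_irreducible`): at a fixed place, reduction is
injective on torsion of order prime to the place, and elements of bounded degree have finitely many
residues. If `x` in `L` is torsion for `φ`, then `u⁻¹ x` is torsion for `ρ`, and its `(D - 1)`-st
power `l * x ^ (D - 1)` lies in `L`, as do the analogous powers of its multiples. So, for `x` of
prime order, the pair `(ρ, u⁻¹ x)` ranges over a finite set.

The pair determines `φ` up to isomorphism over `L`: if `(φ, u, x)` and `(φ', u', x')` give the same
pair, then `u' / u = x' / x` lies in `L` and is an isomorphism (`isIso_of_scale_eq`). -/

/-! ### Linearized polynomials -/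

/-- A polynomial is `q`-linearized if its exponents are powers of `q`. -/
def Polynomial.IsLinearized {R : Type*} [Semiring R] (q : ℕ) (f : R[X]) : Prop :=
  ∀ n ∈ f.support, ∃ i : ℕ, n = q ^ i

namespace Polynomial.IsLinearized

theorem map {R S : Type*} [Semiring R] [Semiring S] {q : ℕ} {f : R[X]} (hf : f.IsLinearized q)
    (g : R →+* S) : (f.map g).IsLinearized q :=
  fun n hn => hf n (support_map_subset g f hn)

theorem of_map {R S : Type*} [Semiring R] [Semiring S] {q : ℕ} {f : R[X]} {g : R →+* S}
    (hg : Function.Injective g) (hf : (f.map g).IsLinearized q) : f.IsLinearized q := by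
  intro n hn
  exact hf n (by rwa [support_map_of_injective f hg])

section CommSemiring

variable {R : Type*} [CommRing R] {q : ℕ} {f g : R[X]}

theorem coeff_eq_zero (hf : f.IsLinearized q) {n : ℕ} (hn : ∀ i, n ≠ q ^ i) : f.coeff n = 0 := by
  by_contra h
  obtain ⟨i, hi⟩ := hf n (mem_support_iff.2 h)
  exact hn i hi

theorem coeff_zero (hf : f.IsLinearized q) (hq : 1 < q) : f.coeff 0 = 0 :=
  hf.coeff_eq_zero fun i h => by
    have := Nat.pow_pos (n := i) (by omega : 0 < q)
    omega

theorem ext (hf : f.IsLinearized q) (hg : g.IsLinearized q)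
    (h : ∀ i, f.coeff (q ^ i) = g.coeff (q ^ i)) : f = g := by
  ext n
  by_cases hn : ∃ i, n = q ^ i
  · obtain ⟨i, rfl⟩ := hn
    exact h i
  · push Not at hn
    rw [hf.coeff_eq_zero hn, hg.coeff_eq_zero hn]

theorem eq_sum (hf : f.IsLinearized q) (hq : 1 < q) {N : ℕ} (hN : f.natDegree < q ^ N) :
    f = ∑ i ∈ Finset.range N, C (f.coeff (q ^ i)) * X ^ q ^ i := by
  ext n
  simp only [finsetSum_coeff, coeff_C_mul, coeff_X_pow, mul_ite, mul_one, mul_zero]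
  by_cases hn : ∃ i, n = q ^ i
  · obtain ⟨i, rfl⟩ := hn
    have : ∀ j, q ^ i = q ^ j ↔ i = j := fun j => (Nat.pow_right_injective hq).eq_iff
    simp only [this, Finset.sum_ite_eq, Finset.mem_range]
    split_ifs with h
    · rfl
    · exact coeff_eq_zero_of_natDegree_lt
        (hN.trans_le (Nat.pow_le_pow_right (by omega) (not_lt.1 h)))
  · push Not at hn
    rw [hf.coeff_eq_zero hn, Finset.sum_eq_zero]
    intro i _
    rw [if_neg (hn i)]

theorem natDegree_eq_pow (hf : f.IsLinearized q) (h0 : f ≠ 0) : ∃ i, f.natDegree = q ^ i :=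
  hf _ (natDegree_mem_support_of_nonzero h0)

end CommSemiring

section CharP

variable {R : Type*} [CommRing R] {p m : ℕ} [hp : Fact p.Prime] [CharP R p] {f g : R[X]}

theorem eval_add (hf : f.IsLinearized (p ^ m)) (x y : R) :
    f.eval (x + y) = f.eval x + f.eval y := by
  simp only [eval_eq_sum, Polynomial.sum, ← Finset.sum_add_distrib]
  refine Finset.sum_congr rfl fun n hn => ?_
  obtain ⟨i, rfl⟩ := hf n hn
  rw [← pow_mul, add_pow_char_pow, mul_add]

/-- In characteristic `p`, raising `g` to the power `q ^ i` twists the coefficients by Frobenius and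
spreads out the exponents. For `i > n` the divisibility in the last branch is false, so the value
there is always `0`. -/
theorem coeff_pow_pow (hm : m ≠ 0) (g : R[X]) (i n : ℕ) :
    (g ^ (p ^ m) ^ i).coeff ((p ^ m) ^ n) =
      if i ≤ n then g.coeff ((p ^ m) ^ (n - i)) ^ (p ^ m) ^ i
      else if (p ^ m) ^ i ∣ (p ^ m) ^ n then 1 else 0 := by
  have hq : 1 < p ^ m := Nat.one_lt_pow hm hp.out.one_lt
  rw [← pow_mul, ← map_iterateFrobenius_expand p g (m * i), coeff_map,
    coeff_expand (pow_pos hp.out.pos _), pow_mul]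
  by_cases h : i ≤ n
  · rw [if_pos (pow_dvd_pow _ h), if_pos h, iterateFrobenius_def, pow_mul,
      Nat.pow_div h (by omega)]
  · have : ¬ (p ^ m) ^ i ∣ (p ^ m) ^ n := fun hd => h ((Nat.pow_dvd_pow_iff_le_right hq).1 hd)
    rw [if_neg this, if_neg h, if_neg this, map_zero]

/-- The rule `τ c = c ^ q τ` in coordinates. Only the outer polynomial has to be linearized. -/
theorem coeff_comp (hm : m ≠ 0) (hf : f.IsLinearized (p ^ m)) (g : R[X]) (n : ℕ) :
    (f.comp g).coeff ((p ^ m) ^ n) = ∑ i ∈ Finset.range (n + 1),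
      f.coeff ((p ^ m) ^ i) * g.coeff ((p ^ m) ^ (n - i)) ^ (p ^ m) ^ i := by
  have hq : 1 < p ^ m := Nat.one_lt_pow hm hp.out.one_lt
  set N := n + 1 + f.natDegree with hN
  have hlt : f.natDegree < (p ^ m) ^ N := lt_of_le_of_lt (by omega) (Nat.lt_pow_self hq)
  conv_lhs => rw [hf.eq_sum hq hlt]
  simp only [Polynomial.sum_comp, mul_comp, C_comp, pow_comp, X_comp, finsetSum_coeff, coeff_C_mul,
    coeff_pow_pow hm]
  rw [← Finset.sum_subset (Finset.range_subset_range.2 (by omega : n + 1 ≤ N))]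
  · refine Finset.sum_congr rfl fun i hi => ?_
    rw [if_pos (by simpa [Nat.lt_succ_iff] using hi)]
  · intro i _ hi
    have hi : ¬ i ≤ n := by simpa [Nat.lt_succ_iff] using hi
    rw [if_neg hi, if_neg, mul_zero]
    exact fun hd => hi ((Nat.pow_dvd_pow_iff_le_right hq).1 hd)

theorem derivative (hm : m ≠ 0) (hf : f.IsLinearized (p ^ m)) :
    Polynomial.derivative f = C (f.coeff 1) := by
  have hq : 1 < p ^ m := Nat.one_lt_pow hm hp.out.one_lt
  have hlt : f.natDegree < (p ^ m) ^ (f.natDegree + 1) :=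
    lt_of_le_of_lt (by omega) (Nat.lt_pow_self hq)
  conv_lhs => rw [hf.eq_sum hq hlt]
  rw [derivative_sum, Finset.sum_eq_single 0]
  · simp
  · intro i _ hi
    simp [derivative_X_pow, hi, hm]
  · simp

end CharP

end Polynomial.IsLinearized

/-! ### Actions by linearized polynomials -/

/-- A ring homomorphism `ρ` from `A` to the ring of `q`-linearized polynomials over `R` under
composition, such that `ρ a` has linear coefficient `ι a`. -/
structure IsLinearizedAction {A R : Type*} [CommRing A] [CommRing R] (q : ℕ) (ι : A →+* R)
    (ρ : A → R[X]) : Prop where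
  isLinearized : ∀ a, (ρ a).IsLinearized q
  one : ρ 1 = X
  add : ∀ a b, ρ (a + b) = ρ a + ρ b
  mul : ∀ a b, ρ (a * b) = (ρ a).comp (ρ b)
  coeff_one : ∀ a, (ρ a).coeff 1 = ι a

namespace IsLinearizedAction

section

variable {A R S : Type*} [CommRing A] [CommRing R] [CommRing S] {q : ℕ} {ι : A →+* R}
  {ρ : A → R[X]}

theorem map (h : IsLinearizedAction q ι ρ) (f : R →+* S) :
    IsLinearizedAction q (f.comp ι) fun a => (ρ a).map f where
  isLinearized a := (h.isLinearized a).map f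
  one := by simp [h.one]
  add a b := by simp [h.add]
  mul a b := by simp [h.mul, map_comp]
  coeff_one a := by simp [h.coeff_one]

theorem of_map {f : R →+* S} (hf : Function.Injective f)
    (h : IsLinearizedAction q (f.comp ι) fun a => (ρ a).map f) : IsLinearizedAction q ι ρ where
  isLinearized a := (h.isLinearized a).of_map hf
  one := map_injective f hf (by simpa using h.one)
  add a b := map_injective f hf (by simpa using h.add a b)
  mul a b := map_injective f hf (by simpa [map_comp] using h.mul a b)
  coeff_one a := hf (by simpa using h.coeff_one a)

theorem zero (h : IsLinearizedAction q ι ρ) : ρ 0 = 0 := by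
  simpa using h.add 0 0

theorem neg (h : IsLinearizedAction q ι ρ) (a : A) : ρ (-a) = -ρ a := by
  rw [eq_neg_iff_add_eq_zero, ← h.add, neg_add_cancel, h.zero]

theorem sub (h : IsLinearizedAction q ι ρ) (a b : A) : ρ (a - b) = ρ a - ρ b := by
  rw [sub_eq_add_neg, h.add, h.neg, sub_eq_add_neg]

theorem comm (h : IsLinearizedAction q ι ρ) (a b : A) :
    (ρ a).comp (ρ b) = (ρ b).comp (ρ a) := by
  rw [← h.mul, ← h.mul, mul_comm]

theorem injective (h : IsLinearizedAction q ι ρ) (hι : Function.Injective ι) :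
    Function.Injective ρ := fun a b hab => hι (by rw [← h.coeff_one, hab, h.coeff_one])

theorem eval_mul (h : IsLinearizedAction q ι ρ) (a b : A) (x : R) :
    (ρ (a * b)).eval x = (ρ a).eval ((ρ b).eval x) := by
  rw [h.mul, eval_comp]

theorem eval_zero (h : IsLinearizedAction q ι ρ) (hq : 1 < q) (a : A) : (ρ a).eval 0 = 0 := by
  rw [← coeff_zero_eq_eval_zero, (h.isLinearized a).coeff_zero hq]

theorem natDegree_pow [IsDomain R] (h : IsLinearizedAction q ι ρ) (a : A) (n : ℕ) :
    (ρ (a ^ n)).natDegree = (ρ a).natDegree ^ n := by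
  induction n with
  | zero => simp [h.one]
  | succ n ih => rw [pow_succ, h.mul, natDegree_comp, ih, pow_succ]

/-- The action obtained by the substitution `x ↦ u x`. -/
theorem scale (h : IsLinearizedAction q ι ρ) (u : Rˣ) :
    IsLinearizedAction q ι fun a => C (↑u⁻¹ : R) * (ρ a).comp (C (u : R) * X) where
  isLinearized a n hn := by
    refine h.isLinearized a n ?_
    rw [mem_support_iff] at hn ⊢
    contrapose! hn
    simp [comp_C_mul_X_coeff, hn]
  one := by simp [h.one, ← mul_assoc, ← C_mul]
  add a b := by simp [h.add, mul_add]
  mul a b := by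
    simp only [h.mul, mul_comp, C_comp, comp_assoc, X_comp]
    congr 3
    rw [← mul_assoc, ← C_mul, Units.mul_inv, C_1, one_mul]
  coeff_one a := by
    simp [comp_C_mul_X_coeff, h.coeff_one, mul_comm (ι a)]

theorem coeff_scale (u : Rˣ) (f : R[X]) (n : ℕ) :
    (C (↑u⁻¹ : R) * f.comp (C (u : R) * X)).coeff n = ↑u⁻¹ * (f.coeff n * (u : R) ^ n) := by
  rw [coeff_C_mul, comp_C_mul_X_coeff]

end

section CharP

variable {A R : Type*} [CommRing A] [CommRing R] {p m : ℕ} [hp : Fact p.Prime] [CharP R p]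
  {ι : A →+* R} {ρ : A → R[X]}

/-- The additive endomorphisms defined by the action. -/
def toEnd (hm : m ≠ 0) (h : IsLinearizedAction (p ^ m) ι ρ) : A →+* AddMonoid.End R where
  toFun a :=
    { toFun := fun x => (ρ a).eval x
      map_zero' := h.eval_zero (Nat.one_lt_pow hm hp.out.one_lt) a
      map_add' := (h.isLinearized a).eval_add }
  map_one' := AddMonoidHom.ext fun x => show (ρ 1).eval x = x by simp [h.one]
  map_mul' a b := AddMonoidHom.ext fun x => h.eval_mul a b x
  map_zero' := AddMonoidHom.ext fun x => show (ρ 0).eval x = 0 by simp [h.zero]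
  map_add' a b := AddMonoidHom.ext fun x =>
    show (ρ (a + b)).eval x = (ρ a).eval x + (ρ b).eval x by simp [h.add]

/-- An action is determined by the image of a single element `t` with `ι t` not algebraic over the
prime field. -/
theorem eq_of_eq [IsDomain R] (hm : m ≠ 0) {ρ' : A → R[X]} (h : IsLinearizedAction (p ^ m) ι ρ)
    (h' : IsLinearizedAction (p ^ m) ι ρ') {t : A} (ht : ∀ n ≠ 0, ι t ^ (p ^ m) ^ n ≠ ι t)
    (ht' : ρ t = ρ' t) : ρ = ρ' := by
  funext a
  refine (h.isLinearized a).ext (h'.isLinearized a) fun n => ?_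
  induction n using Nat.strong_induction_on with
  | _ n ih =>
    rcases Nat.eq_zero_or_pos n with rfl | hn
    · simp [h.coeff_one, h'.coeff_one]
    -- Comparing coefficients of index `q ^ n` in `ρ_a ρ_t = ρ_t ρ_a` isolates the `n`-th
    -- coefficient of `ρ_a`; everything else involves `ρ_t` and lower coefficients of `ρ_a`.
    have key : ∀ ρ'' : A → R[X], IsLinearizedAction (p ^ m) ι ρ'' →
        (ρ'' a).coeff ((p ^ m) ^ n) * (ι t ^ (p ^ m) ^ n - ι t) =
          ∑ i ∈ Finset.range n, (ρ'' t).coeff ((p ^ m) ^ (i + 1)) *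
            (ρ'' a).coeff ((p ^ m) ^ (n - (i + 1))) ^ (p ^ m) ^ (i + 1) -
          ∑ i ∈ Finset.range n, (ρ'' a).coeff ((p ^ m) ^ i) *
            (ρ'' t).coeff ((p ^ m) ^ (n - i)) ^ (p ^ m) ^ i := by
      intro ρ'' h''
      have e := congrArg (fun f => f.coeff ((p ^ m) ^ n)) (h''.comm a t)
      simp only [(h''.isLinearized _).coeff_comp hm] at e
      rw [Finset.sum_range_succ, Finset.sum_range_succ'] at e
      simp only [Nat.sub_self, pow_zero, h''.coeff_one, pow_one, Nat.sub_zero] at e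
      linear_combination e
    have hne : ι t ^ (p ^ m) ^ n - ι t ≠ 0 := sub_ne_zero.2 (ht n hn.ne')
    apply mul_right_cancel₀ hne
    rw [key ρ h, key ρ' h', ht']
    congr 1
    · refine Finset.sum_congr rfl fun i hi => ?_
      rw [ih _ (by omega)]
    · refine Finset.sum_congr rfl fun i hi => ?_
      rw [ih _ (by simpa using hi)]

end CharP

end IsLinearizedAction

/-! ### Finite modules over Dedekind domains -/

section Dedekind

variable {A : Type*} [CommRing A] [IsDedekindDomain A]

/-- In a Dedekind domain some `x` satisfies `I = IJ + (x)`, so `I/IJ` is generated by `x` and is a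
quotient of `A/J`. Each class mod `IJ` is thus a representative mod `I` plus `x` times a
representative mod `J`. -/
theorem Ideal.card_quotient_mul_le {I J : Ideal A} (hI : I ≠ ⊥) (hJ : J ≠ ⊥) [Finite (A ⧸ I)]
    [Finite (A ⧸ J)] : Nat.card (A ⧸ I * J) ≤ Nat.card (A ⧸ I) * Nat.card (A ⧸ J) := by
  obtain ⟨x, hx⟩ := IsDedekindDomain.exists_sup_span_eq (Ideal.mul_le_left : I * J ≤ I)
    (mul_ne_zero hI hJ)
  have hxI : x ∈ I := hx ▸ Ideal.mem_sup_right (Ideal.mem_span_singleton_self x)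
  rw [← Nat.card_prod]
  refine Nat.card_le_card_of_surjective
    (fun z : (A ⧸ I) × (A ⧸ J) => Ideal.Quotient.mk (I * J) (z.1.out + x * z.2.out)) fun c => ?_
  obtain ⟨c, rfl⟩ := Ideal.Quotient.mk_surjective c
  have h1 : c - (Ideal.Quotient.mk I c).out ∈ I := by
    rw [← Ideal.Quotient.eq]
    exact (Quotient.out_eq' _).symm
  replace h1 := hx.ge h1
  rw [Submodule.mem_sup] at h1
  obtain ⟨y, hy, z, hz, hyz⟩ := h1
  obtain ⟨b, rfl⟩ := Ideal.mem_span_singleton'.1 hz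
  have h2 : b - (Ideal.Quotient.mk J b).out ∈ J := by
    rw [← Ideal.Quotient.eq]
    exact (Quotient.out_eq' _).symm
  refine ⟨(Ideal.Quotient.mk I c, Ideal.Quotient.mk J b), ?_⟩
  refine (Ideal.Quotient.eq.2 ?_).symm
  have : c - ((Ideal.Quotient.mk I c).out + x * (Ideal.Quotient.mk J b).out) =
      y + x * (b - (Ideal.Quotient.mk J b).out) := by
    linear_combination -hyz
  rw [this]
  exact add_mem hy (Ideal.mul_mem_mul hxI h2)

/-- Induction on generators. Adjoining `x` to `N` multiplies the cardinality by `#(A/J)`, where `J`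
is the annihilator of `x` modulo `N`, and the new module is killed by `IJ`. -/
theorem Submodule.exists_card_quotient_le_card [Infinite A]
    (hfin : ∀ I : Ideal A, I ≠ ⊥ → Finite (A ⧸ I)) {M : Type*} [AddCommGroup M] [Module A M]
    [Finite M] (N : Submodule A M) :
    ∃ I : Ideal A, I ≠ ⊥ ∧ (∀ a ∈ I, ∀ x ∈ N, a • x = 0) ∧ Nat.card (A ⧸ I) ≤ Nat.card N := by
  obtain ⟨S, rfl⟩ : N.FG := IsNoetherian.noetherian N
  classical
  induction S using Finset.induction_on with
  | empty =>
    refine ⟨⊤, top_ne_bot, by simp, ?_⟩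
    rw [Finset.coe_empty, Submodule.span_empty]
    have : Subsingleton (A ⧸ (⊤ : Ideal A)) := Ideal.Quotient.subsingleton_iff.2 rfl
    simp
  | insert x S _ ih =>
    obtain ⟨I, hI, hIN, hc⟩ := ih
    set N := Submodule.span A (S : Set M) with hN
    set J : Ideal A := N.comap (LinearMap.toSpanSingleton A M x) with hJdef
    have hmemJ : ∀ a, a ∈ J ↔ a • x ∈ N := fun a => by simp [hJdef]
    -- An infinite `A` cannot inject into the finite module by `a ↦ a • x`.
    have hJ : J ≠ ⊥ := by
      intro h0
      refine not_injective_infinite_finite (fun a : A => a • x) fun a b hab => ?_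
      have : a - b ∈ J := by
        rw [hmemJ, sub_smul, show a • x = b • x from hab, sub_self]
        exact N.zero_mem
      rw [h0] at this
      exact sub_eq_zero.1 (by simpa using this)
    have := hfin I hI
    have := hfin J hJ
    have hsp : Submodule.span A ((insert x S : Finset M) : Set M) = Submodule.span A {x} ⊔ N := by
      rw [Finset.coe_insert, Submodule.span_insert]
    refine ⟨I * J, mul_ne_zero hI hJ, ?_, (Ideal.card_quotient_mul_le hI hJ).trans ?_⟩
    · intro a ha y hy
      rw [hsp, Submodule.mem_sup] at hy
      obtain ⟨z, hz, n, hn, rfl⟩ := hy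
      obtain ⟨b, rfl⟩ := Submodule.mem_span_singleton.1 hz
      rw [smul_add, hIN a (Ideal.mul_le_left ha) n hn, add_zero, smul_comm]
      suffices a • x = 0 by rw [this, smul_zero]
      refine Submodule.mul_induction_on ha (fun i hi j hj => ?_) fun i j hi hj => ?_
      · rw [mul_smul]
        exact hIN i hi _ ((hmemJ j).1 hj)
      · rw [add_smul, hi, hj, add_zero]
    · refine (Nat.mul_le_mul_right _ hc).trans ?_
      rw [← Nat.card_prod, hsp]
      refine Nat.card_le_card_of_injective (fun z : N × (A ⧸ J) =>
        (⟨z.2.out • x + z.1, add_mem (Submodule.mem_sup_left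
          (Submodule.smul_mem _ _ (Submodule.mem_span_singleton_self x)))
          (Submodule.mem_sup_right z.1.2)⟩ : ↥(Submodule.span A {x} ⊔ N))) ?_
      rintro ⟨n, a⟩ ⟨n', a'⟩ h
      have h : a.out • x + (n : M) = a'.out • x + n' := congrArg Subtype.val h
      have h2 : a.out - a'.out ∈ J := by
        rw [hmemJ, sub_smul, show a.out • x - a'.out • x = n' - (n : M) by
          rw [sub_eq_sub_iff_add_eq_add, h, add_comm]]
        exact sub_mem n'.2 n.2
      have h3 : a = a' := by
        rw [← Quotient.out_eq' a, ← Quotient.out_eq' a']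
        exact Ideal.Quotient.eq.2 h2
      subst h3
      rw [add_right_inj] at h
      rw [Subtype.ext h]

/-- A finite module over a Dedekind domain has at least as many elements as the quotient of the ring
by the annihilator of the module. -/
theorem card_quotient_ker_le_card [Infinite A]
    (hfin : ∀ I : Ideal A, I ≠ ⊥ → Finite (A ⧸ I)) {G : Type*} [AddCommGroup G] [Finite G]
    (f : A →+* AddMonoid.End G) : Nat.card (A ⧸ RingHom.ker f) ≤ Nat.card G := by
  let _ : Module A G := Module.compHom G f
  obtain ⟨I, hI, hI0, hc⟩ := Submodule.exists_card_quotient_le_card hfin (⊤ : Submodule A G)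
  have := hfin I hI
  have hle : I ≤ RingHom.ker f := fun a ha => by
    rw [RingHom.mem_ker]
    ext x
    exact hI0 a ha x trivial
  calc Nat.card (A ⧸ RingHom.ker f) ≤ Nat.card (A ⧸ I) :=
        Nat.card_le_card_of_surjective _ (Ideal.Quotient.factor_surjective hle)
    _ ≤ Nat.card (⊤ : Submodule A G) := hc
    _ = Nat.card G := Nat.card_congr (Equiv.Set.univ G)

end Dedekind

/-! ### A lower bound for the degrees in generic characteristic -/

theorem Nat.le_of_forall_pow_le_mul_pow {a b C : ℕ} (h : ∀ n, a ^ n ≤ C * b ^ n) : a ≤ b := by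
  by_contra! hab
  rcases Nat.eq_zero_or_pos b with rfl | hb
  · have := h 1
    simp at this
    omega
  have h1 : (1 : ℝ) < a / b := by
    rw [one_lt_div (by exact_mod_cast hb)]
    exact_mod_cast hab
  obtain ⟨n, hn⟩ := pow_unbounded_of_one_lt (C : ℝ) h1
  rw [div_pow, lt_div_iff₀ (by positivity)] at hn
  exact absurd (h n) (not_le.2 (by exact_mod_cast hn))

namespace IsLinearizedAction

section

variable {A k : Type*} [CommRing A] [Field k] {q : ℕ} {ι : A →+* k} {ρ : A → k[X]}

theorem ne_zero (h : IsLinearizedAction q ι ρ) {a : A} (ha : ι a ≠ 0) : ρ a ≠ 0 :=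
  fun h0 => ha (by rw [← h.coeff_one, h0, coeff_zero])

/-- Leading coefficients in `ρ_t ρ_b = ρ_b ρ_t`. For fixed `t` and fixed degree of `ρ_b`, this
leaves few possible leading coefficients of `ρ_b`. -/
theorem leadingCoeff_pow_mul (h : IsLinearizedAction q ι ρ) {t b : A}
    (ht : (ρ t).natDegree ≠ 0) (hb : (ρ b).natDegree ≠ 0) :
    (ρ t).leadingCoeff * (ρ b).leadingCoeff ^ (ρ t).natDegree =
      (ρ b).leadingCoeff * (ρ t).leadingCoeff ^ (ρ b).natDegree := by
  rw [← leadingCoeff_comp hb, ← leadingCoeff_comp ht, h.comm]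

/-- Expand `a` in powers of `t` with digits in a fixed finite set of representatives of `A/tA`; `B`
bounds the degrees of the digits. -/
theorem exists_rep_natDegree_le (h : IsLinearizedAction q ι ρ) {t : A}
    (ht : 1 < (ρ t).natDegree) [Finite (A ⧸ Ideal.span {t})] :
    ∃ B : ℕ, ∀ (n : ℕ) (a : A), ∃ b, t ^ n ∣ a - b ∧
      (ρ b).natDegree ≤ (ρ t).natDegree ^ n * B := by
  obtain ⟨B, hB⟩ : ∃ B, ∀ z : A ⧸ Ideal.span {t}, (ρ z.out).natDegree ≤ B := by
    obtain ⟨B, hB⟩ := (Set.finite_range fun z : A ⧸ Ideal.span {t} => (ρ z.out).natDegree).bddAbove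
    exact ⟨B, fun z => hB ⟨z, rfl⟩⟩
  refine ⟨B, fun n a => ?_⟩
  induction n with
  | zero => exact ⟨0, by simp, by simp [h.zero]⟩
  | succ n ih =>
    obtain ⟨b, ⟨a', ha'⟩, hb⟩ := ih
    set r := (Ideal.Quotient.mk (Ideal.span {t}) a').out with hr
    have h1 : a' - r ∈ Ideal.span {t} := by
      rw [← Ideal.Quotient.eq]
      exact (Quotient.out_eq' _).symm
    obtain ⟨a'', ha''⟩ := Ideal.mem_span_singleton.1 h1
    refine ⟨b + r * t ^ n, ⟨a'', ?_⟩, ?_⟩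
    · linear_combination ha' + t ^ n * ha''
    · rw [h.add]
      refine natDegree_add_le_of_degree_le (hb.trans ?_) ?_
      · exact Nat.mul_le_mul_right _ (Nat.pow_le_pow_right (by omega) (by omega))
      · rw [h.mul, natDegree_comp, h.natDegree_pow, mul_comm]
        exact Nat.mul_le_mul (Nat.pow_le_pow_right (by omega) (by omega)) (hB _)

end

variable {A k : Type*} [CommRing A] [Field k] {p m : ℕ} [hp : Fact p.Prime] [CharP k p]
  {ι : A →+* k} {ρ : A → k[X]}

/-- The elements of `k` killed by `ρ a`. -/
def kernel (hm : m ≠ 0) (h : IsLinearizedAction (p ^ m) ι ρ) (a : A) : AddSubgroup k :=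
  AddMonoidHom.ker (h.toEnd hm a)

theorem mem_kernel (hm : m ≠ 0) (h : IsLinearizedAction (p ^ m) ι ρ) (a : A) (x : k) :
    x ∈ h.kernel hm a ↔ (ρ a).eval x = 0 := Iff.rfl

theorem finite_kernel (hm : m ≠ 0) (h : IsLinearizedAction (p ^ m) ι ρ) {a : A} (ha : ι a ≠ 0) :
    Finite (h.kernel hm a) := by
  refine Set.Finite.subset (s := {x | (ρ a).IsRoot x}) ?_ fun x hx => hx
  exact finite_setOfPred_isRoot (h.ne_zero ha)

theorem card_kernel [IsAlgClosed k] (hm : m ≠ 0) (h : IsLinearizedAction (p ^ m) ι ρ) {a : A}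
    (ha : ι a ≠ 0) : Nat.card (h.kernel hm a) = (ρ a).natDegree := by
  have hsep : (ρ a).Separable := by
    rw [Polynomial.separable_def, (h.isLinearized a).derivative hm, h.coeff_one]
    exact ⟨0, C (ι a)⁻¹, by rw [zero_mul, zero_add, ← C_mul, inv_mul_cancel₀ ha, C_1]⟩
  rw [← card_rootSet_eq_natDegree (K := k) hsep (IsAlgClosed.splits _), ← Nat.card_eq_fintype_card]
  refine Nat.card_congr (Equiv.setCongr ?_)
  ext x
  rw [SetLike.mem_coe, mem_kernel, mem_rootSet, coe_aeval_eq_eval]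
  exact ⟨fun hx => ⟨h.ne_zero ha, hx⟩, fun hx => hx.2⟩

/-- The action of `A` on the kernel of `ρ a`. -/
def kernelEnd (hm : m ≠ 0) (h : IsLinearizedAction (p ^ m) ι ρ) (a : A) :
    A →+* AddMonoid.End (h.kernel hm a) where
  toFun b := ((h.toEnd hm b).comp (h.kernel hm a).subtype).codRestrict _ fun x => by
    change (ρ a).eval ((ρ b).eval (x : k)) = 0
    rw [← h.eval_mul, mul_comm, h.eval_mul, show (ρ a).eval (x : k) = 0 from x.2]
    exact h.eval_zero (Nat.one_lt_pow hm hp.out.one_lt) b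
  map_one' := AddMonoidHom.ext fun x => Subtype.ext (show (ρ 1).eval (x : k) = x by simp [h.one])
  map_mul' a b := AddMonoidHom.ext fun x => Subtype.ext (h.eval_mul a b x)
  map_zero' := AddMonoidHom.ext fun x => Subtype.ext (show (ρ 0).eval (x : k) = 0 by simp [h.zero])
  map_add' a b := AddMonoidHom.ext fun x => Subtype.ext
    (show (ρ (a + b)).eval (x : k) = (ρ a).eval (x : k) + (ρ b).eval (x : k) by simp [h.add])

theorem mem_ker_kernelEnd (hm : m ≠ 0) (h : IsLinearizedAction (p ^ m) ι ρ) (a b : A) :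
    b ∈ RingHom.ker (h.kernelEnd hm a) ↔ ∀ x, (ρ a).eval x = 0 → (ρ b).eval x = 0 := by
  rw [RingHom.mem_ker]
  refine ⟨fun hb x hx => ?_, fun hb => ?_⟩
  · exact congrArg Subtype.val (DFunLike.congr_fun hb (⟨x, hx⟩ : h.kernel hm a))
  · exact AddMonoidHom.ext fun x => Subtype.ext (hb x x.2)

/-- The kernel of `ρ_a` has `deg ρ_a` elements by separability, more than a nonzero `ρ_b` of smaller
degree can have as roots. -/
theorem eq_zero_of_natDegree_lt [IsAlgClosed k] (hm : m ≠ 0) (h : IsLinearizedAction (p ^ m) ι ρ)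
    (hι : Function.Injective ι) {a b : A} (ha : ι a ≠ 0)
    (hb : ∀ x, (ρ a).eval x = 0 → (ρ b).eval x = 0)
    (hlt : (ρ b).natDegree < (ρ a).natDegree) : b = 0 := by
  have := h.finite_kernel hm ha
  have := Fintype.ofFinite (h.kernel hm a)
  apply h.injective hι
  rw [h.zero]
  refine eq_zero_of_natDegree_lt_card_of_eval_eq_zero (ρ b) (f := fun x : h.kernel hm a => (x : k))
    Subtype.val_injective (fun x => hb x x.2) ?_
  rwa [← Nat.card_eq_fintype_card, h.card_kernel hm ha]

/-- Among the elements whose action vanishes on the kernel of `ρ a`, there are few whose degree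
is not much larger than that of `ρ a`. -/
theorem card_le_of_natDegree_lt [IsAlgClosed k] (hm : m ≠ 0) (h : IsLinearizedAction (p ^ m) ι ρ)
    (hι : Function.Injective ι) {t a : A} (ht : 1 < (ρ t).natDegree) (ha : ι a ≠ 0) {n : ℕ}
    (han : (ρ a).natDegree = (p ^ m) ^ n) (j : ℕ) :
    Finite {b : A | (∀ x, (ρ a).eval x = 0 → (ρ b).eval x = 0) ∧
      (ρ b).natDegree < (p ^ m) ^ (n + j)} ∧
    Nat.card {b : A | (∀ x, (ρ a).eval x = 0 → (ρ b).eval x = 0) ∧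
      (ρ b).natDegree < (p ^ m) ^ (n + j)} ≤ (ρ t).natDegree ^ j := by
  have hq : 1 < p ^ m := Nat.one_lt_pow hm hp.out.one_lt
  have hlt0 : (ρ t).leadingCoeff ≠ 0 :=
    leadingCoeff_ne_zero.2 fun h0 => by simp [h0] at ht
  induction j with
  | zero =>
    rw [add_zero, ← han]
    set S := {b : A | (∀ x, (ρ a).eval x = 0 → (ρ b).eval x = 0) ∧
      (ρ b).natDegree < (ρ a).natDegree} with hS
    have hsub : Subsingleton S := by
      refine ⟨fun b c => Subtype.ext ?_⟩
      rw [h.eq_zero_of_natDegree_lt hm hι ha b.2.1 b.2.2,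
        h.eq_zero_of_natDegree_lt hm hι ha c.2.1 c.2.2]
    exact ⟨inferInstance, by simpa using Finite.card_le_one_iff_subsingleton.2 hsub⟩
  | succ j ih =>
    obtain ⟨hf, hc⟩ := ih
    set N := (p ^ m) ^ (n + j) with hN
    have hN0 : N ≠ 0 := (pow_pos (by omega) _).ne'
    set S := {b : A | (∀ x, (ρ a).eval x = 0 → (ρ b).eval x = 0) ∧ (ρ b).natDegree < N} with hS
    set S' := {b : A | (∀ x, (ρ a).eval x = 0 → (ρ b).eval x = 0) ∧
      (ρ b).natDegree < (p ^ m) ^ (n + (j + 1))} with hS'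
    have hdeg : ∀ b ∈ S', (ρ b).natDegree ≤ N := by
      intro b hb
      rcases eq_or_ne (ρ b) 0 with h0 | h0
      · simp [h0]
      obtain ⟨i, hi⟩ := (h.isLinearized b).natDegree_eq_pow h0
      rw [hi]
      have hb2 := hb.2
      rw [hi] at hb2
      have := (Nat.pow_lt_pow_iff_right hq).1 hb2
      exact Nat.pow_le_pow_right (by omega) (by omega)
    -- Raising the degree bound by one power of `q` admits only a new coefficient at `X ^ N`. That
    -- coefficient, zero or leading, is a root of `g`, which leaves at most `deg ρ_t` values.
    set g : k[X] := C (ρ t).leadingCoeff * X ^ (ρ t).natDegree -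
      C ((ρ t).leadingCoeff ^ N) * X with hg
    have hgd : g.natDegree = (ρ t).natDegree := by
      rw [hg, natDegree_sub_eq_left_of_natDegree_lt]
      · exact natDegree_C_mul_X_pow _ _ hlt0
      · rw [natDegree_C_mul_X_pow _ _ hlt0]
        exact lt_of_le_of_lt ((natDegree_C_mul_le _ _).trans natDegree_X_le) ht
    have hg0 : g ≠ 0 := fun h0 => by simp [h0] at hgd; omega
    classical
    set Rt : Finset k := g.roots.toFinset with hRt
    have hroot : ∀ b ∈ S', (ρ b).coeff N ∈ Rt := by
      intro b hb
      rw [hRt, Multiset.mem_toFinset, mem_roots hg0, IsRoot.def]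
      by_cases h0 : (ρ b).coeff N = 0
      · simp [hg, h0, show (ρ t).natDegree ≠ 0 by omega]
      · have hd : (ρ b).natDegree = N := le_antisymm (hdeg b hb) (le_natDegree_of_ne_zero h0)
        have := h.leadingCoeff_pow_mul (t := t) (b := b) (by omega) (by omega)
        rw [leadingCoeff, leadingCoeff, hd] at this
        simp only [hg, Polynomial.eval_sub, Polynomial.eval_mul, eval_C, eval_pow, eval_X, leadingCoeff]
        linear_combination this
    let rep : k → A := fun x => if hx : ∃ b ∈ S', (ρ b).coeff N = x then hx.choose else 0
    have hrep : ∀ b ∈ S', rep ((ρ b).coeff N) ∈ S' ∧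
        (ρ (rep ((ρ b).coeff N))).coeff N = (ρ b).coeff N := by
      intro b hb
      have hx : ∃ c ∈ S', (ρ c).coeff N = (ρ b).coeff N := ⟨b, hb, rfl⟩
      simp only [rep, dif_pos hx]
      exact hx.choose_spec
    -- Subtracting a chosen representative with the same coefficient at `X ^ N` brings `b` below
    -- degree `N`.
    let F : S' → Rt × S := fun b => (⟨_, hroot b b.2⟩, ⟨b - rep ((ρ (b : A)).coeff N), by
      obtain ⟨h1, h2⟩ := hrep b b.2
      refine ⟨fun x hx => by rw [h.sub, Polynomial.eval_sub, b.2.1 x hx, h1.1 x hx, sub_zero], ?_⟩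
      have hle : (ρ ((b : A) - rep ((ρ (b : A)).coeff N))).natDegree ≤ N := by
        rw [h.sub]
        exact (natDegree_sub_le_of_le (hdeg _ b.2) (hdeg _ h1)).trans (max_self N).le
      refine lt_of_le_of_ne hle fun heq => ?_
      have h3 : (ρ ((b : A) - rep ((ρ (b : A)).coeff N))).leadingCoeff = 0 := by
        rw [leadingCoeff, heq, h.sub, coeff_sub, h2, sub_self]
      rw [leadingCoeff_eq_zero] at h3
      rw [h3] at heq
      simp at heq
      omega⟩)
    have hF : Function.Injective F := by
      intro b c hbc
      have h1 : (ρ (b : A)).coeff N = (ρ (c : A)).coeff N :=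
        congrArg (fun z => (z.1 : k)) hbc
      have h2 : (b : A) - rep ((ρ (b : A)).coeff N) = c - rep ((ρ (c : A)).coeff N) :=
        congrArg (fun z => (z.2 : A)) hbc
      rw [h1, sub_left_inj] at h2
      exact Subtype.ext h2
    refine ⟨Finite.of_injective F hF, (Nat.card_le_card_of_injective F hF).trans ?_⟩
    rw [Nat.card_prod, pow_succ, mul_comm]
    refine Nat.mul_le_mul hc ?_
    rw [Nat.card_eq_fintype_card, Fintype.card_coe, ← hgd]
    exact (Multiset.toFinset_card_le _).trans (card_roots' g)

/-- If `A / tⁿ` has `D ^ n` elements, then the degree of `ρ t` is at least `D` unless it is `1`. -/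
theorem le_natDegree_of_card_eq [IsDedekindDomain A] [Infinite A]
    (hfin : ∀ I : Ideal A, I ≠ ⊥ → Finite (A ⧸ I)) [IsAlgClosed k] (hm : m ≠ 0)
    (h : IsLinearizedAction (p ^ m) ι ρ) (hι : Function.Injective ι) {t : A} {D : ℕ}
    (hD : ∀ n, Nat.card (A ⧸ Ideal.span {t ^ n}) = D ^ n) (ht : 1 < (ρ t).natDegree) :
    D ≤ (ρ t).natDegree := by
  have hq : 1 < p ^ m := Nat.one_lt_pow hm hp.out.one_lt
  have ht0 : t ≠ 0 := by
    rintro rfl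
    simp [h.zero] at ht
  have hιt : ∀ n, ι (t ^ n) ≠ 0 := fun n h0 =>
    pow_ne_zero n ht0 (hι (by rw [h0, map_zero]))
  have hspan : ∀ n, Ideal.span {t ^ n} ≠ ⊥ := fun n => by
    simpa [Ideal.span_singleton_eq_bot] using fun h0 => absurd h0 ht0
  have := hfin (Ideal.span {t}) (by simpa using hspan 1)
  obtain ⟨B, hB⟩ := h.exists_rep_natDegree_le ht
  obtain ⟨d, hd⟩ := (h.isLinearized t).natDegree_eq_pow (fun h0 => by simp [h0] at ht)
  -- The count is `#(A/tⁿ) ≤ #(J/tⁿ) · #(A/J)`, with `J` the annihilator of the kernel of `ρ (t ^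
  -- n)`. The second factor is at most `(deg ρ_t) ^ n`; the first is at most `(deg ρ_t) ^ B`,
  -- independently of `n`, because its classes have representatives of small degree.
  refine Nat.le_of_forall_pow_le_mul_pow (C := (ρ t).natDegree ^ B) fun n => ?_
  have hdn : (ρ (t ^ n)).natDegree = (p ^ m) ^ (d * n) := by
    rw [h.natDegree_pow, hd, pow_mul]
  obtain ⟨hSf, hSc⟩ := h.card_le_of_natDegree_lt hm hι ht (hιt n) hdn B
  set S := {b : A | (∀ x, (ρ (t ^ n)).eval x = 0 → (ρ b).eval x = 0) ∧
      (ρ b).natDegree < (p ^ m) ^ (d * n + B)} with hS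
  set J := RingHom.ker (h.kernelEnd hm (t ^ n)) with hJ
  have := h.finite_kernel hm (hιt n)
  have hJc : Nat.card (A ⧸ J) ≤ (ρ t).natDegree ^ n := by
    rw [← h.natDegree_pow, ← h.card_kernel hm (hιt n)]
    exact card_quotient_ker_le_card hfin _
  have htJ : t ^ n ∈ J := (h.mem_ker_kernelEnd hm _ _).2 fun x hx => hx
  have : Finite (A ⧸ J) := hfin J fun h0 => by
    rw [h0] at htJ
    exact pow_ne_zero n ht0 (by simpa using htJ)
  refine le_trans ?_ (Nat.mul_le_mul hSc hJc)
  rw [← hD n, ← Nat.card_prod]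
  refine Nat.card_le_card_of_surjective (fun z : S × (A ⧸ J) =>
    Ideal.Quotient.mk (Ideal.span {t ^ n}) (z.1 + z.2.out)) fun a => ?_
  obtain ⟨a, rfl⟩ := Ideal.Quotient.mk_surjective a
  have h1 : a - (Ideal.Quotient.mk J a).out ∈ J := by
    rw [← Ideal.Quotient.eq]
    exact (Quotient.out_eq' _).symm
  obtain ⟨b, hb, hbd⟩ := hB n (a - (Ideal.Quotient.mk J a).out)
  -- Since `t ^ n` lies in `J`, reducing modulo `t ^ n` to bounded degree does not leave `J`.
  have hbJ : b ∈ J := by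
    have := J.sub_mem h1 (J.mem_of_dvd hb htJ)
    simpa using this
  refine ⟨(⟨b, (h.mem_ker_kernelEnd hm _ _).1 hbJ, lt_of_le_of_lt hbd ?_⟩,
    Ideal.Quotient.mk J a), ?_⟩
  · rw [pow_add, pow_mul, ← hd]
    exact Nat.mul_lt_mul_of_pos_left (Nat.lt_pow_self hq) (pow_pos (by omega) _)
  · refine (Ideal.Quotient.eq.2 (Ideal.mem_span_singleton.2 ?_)).symm
    rw [← sub_sub]
    rwa [sub_right_comm] at hb

end IsLinearizedAction

/-! ### Good reduction -/

/-- Choosing the last maximum gives strict inequality on one side, which singles out a dominant term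
in a coefficient of a composition. -/
theorem exists_last_max {Γ : Type*} [LinearOrder Γ] {f : ℕ → Γ} {z : Γ} {N j : ℕ}
    (hf : ∀ n, N ≤ n → f n = z) (hj : z < f j) :
    ∃ i, f j ≤ f i ∧ (∀ n, f n ≤ f i) ∧ ∀ n, i < n → f n < f i := by
  have hjN : j ∈ Finset.range N := by
    rw [Finset.mem_range]
    by_contra! h
    exact hj.ne' (hf j h)
  obtain ⟨i, hi, hmax⟩ := Finset.exists_max_image (Finset.range N) f ⟨j, hjN⟩
  have hmax' : ∀ n, f n ≤ f i := fun n => by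
    rcases lt_or_ge n N with h | h
    · exact hmax n (Finset.mem_range.2 h)
    · rw [hf n h]
      exact hj.le.trans (hmax j hjN)
  obtain ⟨l, hl, hlast⟩ := Finset.exists_max_image ((Finset.range N).filter fun n => f n = f i) id
    ⟨i, Finset.mem_filter.2 ⟨hi, rfl⟩⟩
  have hli := (Finset.mem_filter.1 hl).2
  refine ⟨l, hli ▸ hmax' j, hli ▸ hmax', fun n hn => hli ▸ lt_of_le_of_ne (hmax' n) fun h => ?_⟩
  have hnN : n < N := by
    by_contra! hN
    rw [hf n hN] at h
    exact absurd (hmax' j) (not_le.2 (h ▸ hj))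
  exact absurd (hlast n (Finset.mem_filter.2 ⟨Finset.mem_range.2 hnN, h⟩)) (not_le.2 hn)

/-- A linearized polynomial that commutes with an integral one of positive reduced height is
integral. -/
theorem Polynomial.IsLinearized.valuation_coeff_le_one {K Γ : Type*} [Field K]
    [LinearOrderedCommGroupWithZero Γ] (v : Valuation K Γ) {p m : ℕ} [hp : Fact p.Prime] [CharP K p]
    (hm : m ≠ 0) {f g : K[X]} (hf : f.IsLinearized (p ^ m)) (hg : g.IsLinearized (p ^ m))
    (hfg : f.comp g = g.comp f) (hfv : ∀ i, v (f.coeff ((p ^ m) ^ i)) ≤ 1) {i₁ : ℕ} (hi₁ : i₁ ≠ 0)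
    (hfi : v (f.coeff ((p ^ m) ^ i₁)) = 1) (j : ℕ) : v (g.coeff ((p ^ m) ^ j)) ≤ 1 := by
  have hq : 1 < p ^ m := Nat.one_lt_pow hm hp.out.one_lt
  by_contra! hj
  have hzero : ∀ (f : K[X]) (n : ℕ), f.natDegree ≤ n → n ≠ 0 → f.coeff ((p ^ m) ^ n) = 0 :=
    fun f n hn _ => coeff_eq_zero_of_natDegree_lt (lt_of_le_of_lt hn (Nat.lt_pow_self hq))
  obtain ⟨J, hjJ, hJ, hJlast⟩ := exists_last_max (f := fun j => v (g.coeff ((p ^ m) ^ j))) (z := 0)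
    (N := g.natDegree + 1) (j := j)
    (fun n hn => by simp [hzero g n (by omega) (by omega)]) (lt_trans one_pos hj)
  set r := v (g.coeff ((p ^ m) ^ J)) with hr
  have hr1 : 1 < r := hj.trans_le hjJ
  have hr0 : 0 < r := one_pos.trans hr1
  obtain ⟨I, hiI, hI, hIlast⟩ := exists_last_max
    (f := fun i => v (f.coeff ((p ^ m) ^ i)) * r ^ (p ^ m) ^ i) (z := 0)
    (N := f.natDegree + 1) (j := i₁)
    (fun n hn => by simp [hzero f n (by omega) (by omega)])
    (by simp only [hfi, one_mul]; exact pow_pos hr0 _)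
  set s := v (f.coeff ((p ^ m) ^ I)) * r ^ (p ^ m) ^ I with hs
  have hrs : r < s := by
    refine lt_of_lt_of_le ?_ hiI
    simp only [hfi, one_mul]
    exact lt_self_pow₀ hr1 (Nat.one_lt_pow hi₁ hq)
  have hs0 : 0 < s := hr0.trans hrs
  -- At index `I + J` the term `i = I` strictly dominates: for `i < I` the index `I + J - i` lies
  -- beyond the last maximum `J`, and for `i > I` maximality of `I` is strict. In the opposite order
  -- every term has size at most `r < s`.
  have h1 : v ((f.comp g).coeff ((p ^ m) ^ (I + J))) = s := by
    rw [hf.coeff_comp hm, Valuation.map_sum_eq_of_lt (j := I) v (by simp)]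
    · rw [Nat.add_sub_cancel_left, map_mul, map_pow]
    · intro i hi
      rw [Nat.add_sub_cancel_left, map_mul, map_mul, map_pow, map_pow]
      change _ < s
      obtain ⟨-, hne⟩ := Finset.mem_sdiff.1 hi
      rw [Finset.mem_singleton] at hne
      rcases lt_or_gt_of_ne hne with hlt | hlt
      · rcases eq_or_ne (v (f.coeff ((p ^ m) ^ i))) 0 with h0 | h0
        · rw [h0, zero_mul]
          exact hs0
        · refine lt_of_lt_of_le ?_ (hI i)
          refine mul_lt_mul_of_pos_left ?_ (zero_lt_iff.2 h0)
          exact pow_lt_pow_left₀ (hJlast _ (by omega)) zero_le (pow_pos (by omega) _).ne'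
      · refine lt_of_le_of_lt ?_ (hIlast i hlt)
        exact mul_le_mul_right (pow_le_pow_left₀ zero_le (hJ _) _) _
  have h2 : v ((g.comp f).coeff ((p ^ m) ^ (I + J))) ≤ r := by
    rw [hg.coeff_comp hm]
    refine Valuation.map_sum_le v fun i _ => ?_
    rw [map_mul, map_pow]
    exact (mul_le_of_le_one_right' (pow_le_one₀ zero_le (hfv _))).trans (hJ i)
  rw [hfg] at h1
  exact absurd (h1 ▸ h2) (not_le.2 hrs)

/-- A monic lift of an irreducible polynomial has a root in `K`; the root is integral over `W`,
hence in `W`, and reduces to a root. -/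
theorem ValuationSubring.isAlgClosed_residueField {K : Type*} [Field K] [IsAlgClosed K]
    (W : ValuationSubring K) : IsAlgClosed (IsLocalRing.ResidueField W) := by
  refine IsAlgClosed.of_exists_root _ fun f hf hirr => ?_
  obtain ⟨g, hgf, hdeg, hg⟩ := lifts_and_natDegree_eq_and_monic
    ((mem_lifts f).2 (map_surjective _ IsLocalRing.residue_surjective f)) hf
  have hne : (g.map (algebraMap W K)).degree ≠ 0 := by
    rw [degree_map_eq_of_injective (IsFractionRing.injective W K),
      ← degree_map_eq_of_leadingCoeff_ne_zero (IsLocalRing.residue W) (by simp [hg.leadingCoeff]),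
      hgf]
    exact hirr.degree_pos.ne'
  obtain ⟨x, hx⟩ := IsAlgClosed.exists_root _ hne
  have hxi : IsIntegral W x := ⟨g, hg, by rwa [IsRoot.def, eval_map] at hx⟩
  obtain ⟨y, rfl⟩ := IsIntegrallyClosed.isIntegral_iff.1 hxi
  refine ⟨IsLocalRing.residue W y, ?_⟩
  rw [IsRoot.def, eval_map_algebraMap, aeval_algebraMap_apply] at hx
  have hx := IsFractionRing.injective W K (hx.trans (map_zero _).symm)
  rw [coe_aeval_eq_eval] at hx
  rw [← hgf, eval_map, eval₂_hom, hx, map_zero]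

namespace IsLinearizedAction

variable {A K : Type*} [CommRing A] [Field K] {p m : ℕ} [hp : Fact p.Prime] [CharP K p]
  {ι : A →+* K} {ρ : A → K[X]}

/-- An integral action whose reduction is not just scalar has the reduced degree bounded below. -/
theorem le_natDegree_of_valuation_coeff_lt [IsDedekindDomain A] [Infinite A]
    (hfin : ∀ I : Ideal A, I ≠ ⊥ → Finite (A ⧸ I)) [IsAlgClosed K] (hm : m ≠ 0)
    (h : IsLinearizedAction (p ^ m) ι ρ) {t : A} {D : ℕ}
    (hD : ∀ n, Nat.card (A ⧸ Ideal.span {t ^ n}) = D ^ n) (W : ValuationSubring K)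
    (hW : ∀ a ≠ 0, W.valuation (ι a) = 1)
    (hle : ∀ i, W.valuation ((ρ t).coeff ((p ^ m) ^ i)) ≤ 1) {i₁ : ℕ} (hi₁ : i₁ ≠ 0)
    (hi : W.valuation ((ρ t).coeff ((p ^ m) ^ i₁)) = 1) :
    ∃ n, D ≤ n ∧ W.valuation ((ρ t).coeff n) = 1 := by
  have hq : 1 < p ^ m := Nat.one_lt_pow hm hp.out.one_lt
  -- Integrality spreads from `ρ_t` to every `ρ_a` by commutation.
  have hmem : ∀ a n, (ρ a).coeff n ∈ W := by
    intro a n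
    rw [← W.valuation_le_one_iff]
    by_cases hn : ∃ j, n = (p ^ m) ^ j
    · obtain ⟨j, rfl⟩ := hn
      exact (h.isLinearized t).valuation_coeff_le_one W.valuation hm (h.isLinearized a)
        (h.comm t a) hle hi₁ hi j
    · push Not at hn
      rw [(h.isLinearized a).coeff_eq_zero hn, map_zero]
      exact zero_le
  have hιW : ∀ a, ι a ∈ W := fun a => h.coeff_one a ▸ hmem a 1
  have hlift : ∀ a, ∃ f : W[X], f.map (W.subtype) = ρ a := fun a =>
    (mem_lifts _).1 ((lifts_iff_coeff_lifts _).2 fun n => ⟨⟨_, hmem a n⟩, rfl⟩)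
  choose σ hσ using hlift
  let ιW : A →+* W := ι.codRestrict W hιW
  have hσa : IsLinearizedAction (p ^ m) ιW σ := by
    refine of_map (f := W.subtype) W.subtype_injective ?_
    simp only [hσ]
    exact h
  have hcoeff : ∀ a n, ((σ a).coeff n : K) = (ρ a).coeff n := fun a n => by
    rw [← hσ a, coeff_map]
    rfl
  have hres : ∀ w : W, IsLocalRing.residue W w ≠ 0 ↔ W.valuation w = 1 := by
    intro w
    rw [IsLocalRing.residue_ne_zero_iff_isUnit, W.valuation_eq_one_iff]
  have := W.isAlgClosed_residueField
  have : CharP (IsLocalRing.ResidueField W) p := by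
    have : CharP W p := (RingHom.charP_iff W.subtype W.subtype_injective p).2 ‹_›
    exact CharP.of_ringHom_of_ne_zero (IsLocalRing.residue W) p hp.out.ne_zero
  have hbar := hσa.map (IsLocalRing.residue W)
  -- Since the valuation is trivial on `A`, the reduced action is still of generic characteristic,
  -- and the lower bound for degrees applies to it.
  have hinj : Function.Injective ((IsLocalRing.residue W).comp ιW) := by
    rw [injective_iff_map_eq_zero]
    intro a ha
    by_contra h0
    exact (hres (ιW a)).2 (hW a h0) ha
  have hdeg : 1 < ((σ t).map (IsLocalRing.residue W)).natDegree := by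
    refine lt_of_lt_of_le (Nat.one_lt_pow hi₁ hq) (le_natDegree_of_ne_zero ?_)
    rw [coeff_map, hres, hcoeff]
    exact hi
  refine ⟨_, hbar.le_natDegree_of_card_eq hfin hm hinj hD hdeg, ?_⟩
  rw [← hcoeff, ← hres, ← coeff_map]
  refine leadingCoeff_ne_zero.2 fun h0 => ?_
  rw [h0] at hdeg
  simp at hdeg

/-- Potential good reduction in rank one. -/
theorem coeff_mem_valuationSubring [IsDedekindDomain A] [Infinite A]
    (hfin : ∀ I : Ideal A, I ≠ ⊥ → Finite (A ⧸ I)) [IsAlgClosed K] (hm : m ≠ 0)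
    (h : IsLinearizedAction (p ^ m) ι ρ) {t : A} {D : ℕ} (hD1 : 1 < D)
    (hD : ∀ n, Nat.card (A ⧸ Ideal.span {t ^ n}) = D ^ n) (hmonic : (ρ t).Monic)
    (hdeg : (ρ t).natDegree = D) (W : ValuationSubring K)
    (hW : ∀ a ≠ 0, W.valuation (ι a) = 1) (n : ℕ) : (ρ t).coeff n ∈ W := by
  have hq : 1 < p ^ m := Nat.one_lt_pow hm hp.out.one_lt
  set v := W.valuation with hv
  set c : ℕ → K := fun i => (ρ t).coeff ((p ^ m) ^ i) with hc
  have hqi : ∀ i, i ≠ 0 → (p ^ m) ^ i - 1 ≠ 0 := fun i hi => by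
    have := Nat.one_lt_pow hi hq
    omega
  obtain ⟨d, hd⟩ := (h.isLinearized t).natDegree_eq_pow hmonic.ne_zero
  have hcd : c d = 1 := by
    simp only [hc]
    rw [← hd]
    exact hmonic
  have hd0 : d ≠ 0 := by
    rintro rfl
    rw [pow_zero] at hd
    omega
  by_contra hn
  obtain ⟨j, rfl⟩ : ∃ j, n = (p ^ m) ^ j := by
    by_contra! h0
    exact hn ((h.isLinearized t).coeff_eq_zero h0 ▸ W.zero_mem)
  have hj0 : j ≠ 0 := by
    rintro rfl
    rw [pow_zero, h.coeff_one] at hn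
    rcases eq_or_ne t 0 with rfl | ht
    · rw [map_zero] at hn
      exact hn W.zero_mem
    · exact hn ((W.valuation_le_one_iff _).1 (hW t ht).le)
  have hcj : c j ≠ 0 := fun h0 => hn <| by
    rw [show (ρ t).coeff ((p ^ m) ^ j) = 0 from h0]
    exact W.zero_mem
  -- Scaling by `u i` turns the coefficient `c i` into `1`. Scaling by the one of least valuation
  -- makes all coefficients integral and one of positive index a unit.
  have hex : ∀ i, ∃ u : K, i ≠ 0 → c i ≠ 0 → c i * u ^ ((p ^ m) ^ i - 1) = 1 := by
    intro i
    by_cases hi : i ≠ 0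
    · obtain ⟨u, hu⟩ := IsAlgClosed.exists_pow_nat_eq (c i)⁻¹ (Nat.pos_of_ne_zero (hqi i hi))
      exact ⟨u, fun _ h0 => by rw [hu, mul_inv_cancel₀ h0]⟩
    · exact ⟨0, fun h0 => absurd h0 hi⟩
  choose u hu using hex
  have hlt : ∀ i, c i ≠ 0 → i ∈ Finset.range (D + 1) := fun i hi => by
    rw [Finset.mem_range, ← hdeg]
    have := le_natDegree_of_ne_zero hi
    have := Nat.lt_pow_self hq (n := i)
    omega
  classical
  obtain ⟨l, hl, hmin⟩ := Finset.exists_min_image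
    ((Finset.range (D + 1)).filter fun i => i ≠ 0 ∧ c i ≠ 0) (fun i => v (u i))
    ⟨j, Finset.mem_filter.2 ⟨hlt j hcj, hj0, hcj⟩⟩
  obtain ⟨-, hl0, hcl⟩ := Finset.mem_filter.1 hl
  have hmin' : ∀ i, i ≠ 0 → c i ≠ 0 → v (u l) ≤ v (u i) := fun i hi hci =>
    hmin i (Finset.mem_filter.2 ⟨hlt i hci, hi, hci⟩)
  have hul : u l ≠ 0 := fun h0 => by
    have := hu l hl0 hcl
    rw [h0, zero_pow (hqi l hl0), mul_zero] at this
    exact zero_ne_one this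
  have hsc := h.scale (Units.mk0 (u l) hul)
  have hco : ∀ i, (C (↑(Units.mk0 (u l) hul)⁻¹ : K) * (ρ t).comp
      (C (↑(Units.mk0 (u l) hul) : K) * X)).coeff ((p ^ m) ^ i) =
        c i * u l ^ ((p ^ m) ^ i - 1) := by
    intro i
    rw [coeff_scale, Units.val_inv_eq_inv_val, Units.val_mk0]
    have : u l ^ (p ^ m) ^ i = u l ^ ((p ^ m) ^ i - 1) * u l := by
      rw [← pow_succ, Nat.sub_add_cancel (Nat.one_le_pow _ _ (by omega))]
    rw [this]
    field_simp
    rfl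
  have hle : ∀ i, v (c i * u l ^ ((p ^ m) ^ i - 1)) ≤ 1 := by
    intro i
    rcases eq_or_ne i 0 with rfl | hi
    · simp only [hc, pow_zero, Nat.sub_self, mul_one, h.coeff_one]
      rcases eq_or_ne t 0 with rfl | ht
      · simp
      · exact (hW t ht).le
    rcases eq_or_ne (c i) 0 with h0 | h0
    · simp [h0]
    · rw [← map_one v, ← hu i hi h0, map_mul, map_mul, map_pow, map_pow]
      exact mul_le_mul_right (pow_le_pow_left₀ zero_le (hmin' i hi h0) _) _
  obtain ⟨e, hDe, he⟩ := hsc.le_natDegree_of_valuation_coeff_lt hfin hm hD W hW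
    (fun i => by rw [hco]; exact hle i) hl0 (by rw [hco, hu l hl0 hcl, map_one])
  -- The non-integral `c j` forces a small scaling factor. By the lower bound the scaled coefficient
  -- of index `D` must be a unit, but it equals `u l ^ (D - 1)`, of valuation less than `1`.
  have huj : v (u l) < 1 := by
    refine (hmin' j hj0 hcj).trans_lt ?_
    by_contra! h1
    refine hn ((W.valuation_le_one_iff _).1 ?_)
    change v (c j) ≤ 1
    calc v (c j) ≤ v (c j) * v (u j) ^ ((p ^ m) ^ j - 1) :=
          le_mul_of_one_le_right' (one_le_pow₀ h1)
      _ = 1 := by rw [← map_pow, ← map_mul, hu j hj0 hcj, map_one]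
  have heD : e = D := by
    refine le_antisymm ?_ hDe
    rw [← hdeg]
    refine le_natDegree_of_ne_zero fun h0 => ?_
    rw [coeff_scale, h0, zero_mul, mul_zero, map_zero] at he
    exact zero_ne_one he
  rw [heD, ← hdeg, hd, hco, hcd, one_mul, map_pow] at he
  exact absurd he (pow_lt_one₀ zero_le huj (hqi d hd0)).ne

end IsLinearizedAction

/-! ### Finiteness of normalized actions -/

/-- An algebraically closed subfield is integrally closed in `K`, hence an intersection of valuation
rings of `K`. -/
theorem IsAlgClosed.exists_valuationSubring_notMem {k K : Type*} [Field k] [IsAlgClosed k] [Field K]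
    (f : k →+* K) {x : K} (hx : x ∉ f.range) :
    ∃ W : ValuationSubring K, (∀ c, f c ∈ W) ∧ x ∉ W := by
  have : IsIntegrallyClosedIn f.range K := by
    rw [Subring.isIntegrallyClosedIn_iff]
    rintro y ⟨g, hg, hgy⟩
    obtain ⟨g', rfl, -, hg'⟩ := lifts_and_natDegree_eq_and_monic
      ((mem_lifts g).2 (map_surjective _ f.rangeRestrict_surjective g)) hg
    rw [eval₂_map] at hgy
    have hgy : eval₂ f y g' = 0 := hgy
    exact (IsAlgClosed.splits g').mem_range_of_isRoot hg'.ne_zero (by rwa [IsRoot.def, eval_map])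
  obtain ⟨W, hW, hxW⟩ := Subring.exists_le_valuationSubring_of_isIntegrallyClosedIn hx
  exact ⟨W, fun c => hW ⟨c, rfl⟩, hxW⟩

/-- A polynomial over a power of `R`, given by a family of polynomials of bounded degree. -/
def Polynomial.ofFamily {I R : Type*} [CommRing R] (f : I → R[X]) (N : ℕ) : (I → R)[X] :=
  ∑ j ∈ Finset.range (N + 1), C (fun i => (f i).coeff j) * X ^ j

section

variable {I R : Type*} [CommRing R]

theorem Polynomial.pi_ext {f g : (I → R)[X]}
    (h : ∀ i, f.map (Pi.evalRingHom (fun _ => R) i) = g.map (Pi.evalRingHom (fun _ => R) i)) :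
    f = g := by
  ext n i
  simpa using congrArg (fun f => f.coeff n) (h i)

theorem Polynomial.coeff_ofFamily {f : I → R[X]} {N : ℕ} (h : ∀ i, (f i).natDegree ≤ N) (n : ℕ)
    (i : I) : (ofFamily f N).coeff n i = (f i).coeff n := by
  simp only [ofFamily, finsetSum_coeff, coeff_C_mul, coeff_X_pow, mul_ite, mul_one, mul_zero,
    Finset.sum_ite_eq, Finset.mem_range]
  split_ifs with hn
  · rfl
  · exact (coeff_eq_zero_of_natDegree_lt (by have := h i; omega)).symm

theorem Polynomial.map_ofFamily {f : I → R[X]} {N : ℕ} (h : ∀ i, (f i).natDegree ≤ N) (i : I) :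
    (ofFamily f N).map (Pi.evalRingHom (fun _ => R) i) = f i := by
  ext n
  rw [coeff_map]
  exact coeff_ofFamily h n i

/-- The bound `d`, uniform in the family, is what lets the polynomials assemble into one over the
product ring. -/
theorem IsLinearizedAction.ofFamily {A : Type*} [CommRing A] {q : ℕ} {ι : A →+* R}
    {ρ : I → A → R[X]} (h : ∀ i, IsLinearizedAction q ι (ρ i)) {d : A → ℕ}
    (hd : ∀ i a, (ρ i a).natDegree ≤ d a) :
    IsLinearizedAction q (RingHom.pi fun _ : I => ι)
      fun a => Polynomial.ofFamily (fun i => ρ i a) (d a) where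
  isLinearized a n hn := by
    rw [mem_support_iff] at hn
    obtain ⟨i, hi⟩ := Function.ne_iff.1 hn
    rw [coeff_ofFamily fun i => hd i a] at hi
    exact (h i).isLinearized a n (mem_support_iff.2 hi)
  one := Polynomial.pi_ext fun i => by rw [map_ofFamily fun i => hd i 1, (h i).one, map_X]
  add a b := Polynomial.pi_ext fun i => by
    rw [Polynomial.map_add, map_ofFamily fun i => hd i _, map_ofFamily fun i => hd i _,
      map_ofFamily fun i => hd i _, (h i).add]
  mul a b := Polynomial.pi_ext fun i => by
    rw [map_comp, map_ofFamily fun i => hd i _, map_ofFamily fun i => hd i _,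
      map_ofFamily fun i => hd i _, (h i).mul]
  coeff_one a := by
    ext i
    rw [coeff_ofFamily fun i => hd i a, (h i).coeff_one]
    rfl

end

/-- Take `M` containing all finitely supported sequences. An injective `c` meets `y` at most once,
so a finitely supported change turns `c - y` into a unit. -/
theorem exists_isMaximal_pi (k : Type*) [Field k] :
    ∃ M : Ideal (ℕ → k), M.IsMaximal ∧
      ∀ c : ℕ → k, Function.Injective c → ∀ y, c - Function.const ℕ y ∉ M := by
  let I : Ideal (ℕ → k) :=
    { carrier := {f | f.support.Finite}
      zero_mem' := by simp
      add_mem' := fun {f g} hf hg => (hf.union hg).subset (Function.support_add f g)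
      smul_mem' := fun c f hf => hf.subset (Function.support_smul_subset_right c f) }
  have hI : I ≠ ⊤ := by
    rw [Ideal.ne_top_iff_one]
    intro h
    have h : (Function.support (1 : ℕ → k)).Finite := h
    rw [Function.support_one] at h
    exact Set.infinite_univ h
  obtain ⟨M, hM, hIM⟩ := I.exists_le_maximal hI
  refine ⟨M, hM, fun c hc y hy => hM.ne_top ?_⟩
  classical
  set e : ℕ → k := fun i => if c i = y then 1 else 0 with he
  have heI : e ∈ I := by
    refine Set.Finite.subset (s := {i | c i = y}) ?_ fun i hi => ?_
    · exact Set.Subsingleton.finite fun i hi j hj => hc (hi.trans hj.symm)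
    · by_contra h
      exact hi (if_neg h)
  have hu : IsUnit (c - Function.const ℕ y + e) := by
    rw [Pi.isUnit_iff]
    intro i
    by_cases h : c i = y
    · simp [he, h]
    · simp [he, h, sub_ne_zero]
  exact Ideal.eq_top_of_isUnit_mem _ (M.add_mem hy (hIM heI)) hu

namespace IsLinearizedAction

variable {A k : Type*} [CommRing A] [Field k] {p m : ℕ} [hp : Fact p.Prime] [CharP k p]
  {ι : A →+* k}

/-- Infinitely many values give an injective sequence, whose class in the ultraproduct lies outside
`k`. Some valuation ring containing `k` omits it, against potential good reduction. -/
theorem finite_coeff [IsDedekindDomain A] [Infinite A]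
    (hfin : ∀ I : Ideal A, I ≠ ⊥ → Finite (A ⧸ I)) [IsAlgClosed k] (hm : m ≠ 0)
    (hι : Function.Injective ι) {t : A} {D : ℕ} (hD1 : 1 < D)
    (hD : ∀ n, Nat.card (A ⧸ Ideal.span {t ^ n}) = D ^ n) (d : A → ℕ) (n : ℕ) :
    {c : k | ∃ ρ : A → k[X], IsLinearizedAction (p ^ m) ι ρ ∧ (ρ t).Monic ∧
      (ρ t).natDegree = D ∧ (∀ a, (ρ a).natDegree ≤ d a) ∧ (ρ t).coeff n = c}.Finite := by
  by_contra hinf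
  let c := Set.Infinite.natEmbedding _ hinf
  choose ρ hρ hmonic hdeg hd hc using fun i => (c i).2
  obtain ⟨M, hM, hcM⟩ := exists_isMaximal_pi k
  let _ : Field ((ℕ → k) ⧸ M) := Ideal.Quotient.field M
  let g : (ℕ → k) →+* AlgebraicClosure ((ℕ → k) ⧸ M) :=
    (algebraMap _ _).comp (Ideal.Quotient.mk M)
  let f : k →+* AlgebraicClosure ((ℕ → k) ⧸ M) := g.comp (Pi.constRingHom ℕ k)
  have : CharP (AlgebraicClosure ((ℕ → k) ⧸ M)) p := (RingHom.charP_iff f f.injective p).1 ‹_›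
  have hfam := IsLinearizedAction.ofFamily hρ hd
  set σ : A → (ℕ → k)[X] := fun a => Polynomial.ofFamily (fun i => ρ i a) (d a) with hσ
  have hcoeff : ∀ j i, (σ t).coeff j i = (ρ i t).coeff j := fun j i =>
    coeff_ofFamily (fun i => hd i t) j i
  have hσD : (σ t).coeff D = 1 := by
    ext i
    rw [hcoeff, ← hdeg i]
    exact hmonic i
  have hσle : (σ t).natDegree ≤ D := by
    refine natDegree_le_iff_coeff_eq_zero.2 fun j hj => ?_
    ext i
    rw [hcoeff]
    exact coeff_eq_zero_of_natDegree_lt (by rw [hdeg]; exact hj)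
  have hσm : (σ t).Monic := monic_of_natDegree_le_of_coeff_eq_one D hσle hσD
  have hσd : (σ t).natDegree = D :=
    le_antisymm hσle (le_natDegree_of_ne_zero (by rw [hσD]; exact one_ne_zero))
  have hact := hfam.map g
  have hιf : ∀ a, (g.comp (RingHom.pi fun _ : ℕ => ι)) a = f (ι a) := fun a => rfl
  have hx : g ((σ t).coeff n) ∈ f.range := by
    by_contra hx
    obtain ⟨W, hW, hxW⟩ := IsAlgClosed.exists_valuationSubring_notMem f hx
    refine hxW ?_
    rw [← coeff_map]
    refine hact.coeff_mem_valuationSubring hfin hm hD1 hD (hσm.map g)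
      (by rw [hσm.natDegree_map, hσd]) W (fun a ha => ?_) n
    have h0 : ι a ≠ 0 := fun h0 => ha (hι (h0.trans (map_zero ι).symm))
    rw [hιf]
    refine le_antisymm ((W.valuation_le_one_iff _).2 (hW _)) ?_
    have h1 := (W.valuation_le_one_iff _).2 (hW (ι a)⁻¹)
    rw [map_inv₀, map_inv₀] at h1
    exact (inv_le_one₀ (zero_lt_iff.2 (by simpa using h0))).1 h1
  obtain ⟨y, hy⟩ := hx
  refine hcM ((σ t).coeff n) (fun i j hij => ?_) y ?_
  · rw [hcoeff, hcoeff, hc, hc] at hij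
    exact c.injective (Subtype.ext hij)
  · rw [← Ideal.Quotient.eq]
    exact (algebraMap ((ℕ → k) ⧸ M) _).injective hy.symm

theorem finite_setOf_monic [IsDedekindDomain A] [Infinite A]
    (hfin : ∀ I : Ideal A, I ≠ ⊥ → Finite (A ⧸ I)) [IsAlgClosed k] (hm : m ≠ 0)
    (hι : Function.Injective ι) {t : A} {D : ℕ} (hD1 : 1 < D)
    (hD : ∀ n, Nat.card (A ⧸ Ideal.span {t ^ n}) = D ^ n)
    (ht : ∀ n ≠ 0, ι t ^ (p ^ m) ^ n ≠ ι t) (d : A → ℕ) :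
    {ρ : A → k[X] | IsLinearizedAction (p ^ m) ι ρ ∧ (ρ t).Monic ∧
      (ρ t).natDegree = D ∧ ∀ a, (ρ a).natDegree ≤ d a}.Finite := by
  set Z := {ρ : A → k[X] | IsLinearizedAction (p ^ m) ι ρ ∧ (ρ t).Monic ∧
      (ρ t).natDegree = D ∧ ∀ a, (ρ a).natDegree ≤ d a} with hZ
  have hT : (Set.pi Set.univ fun n : Fin (D + 1) =>
      {c : k | ∃ ρ : A → k[X], IsLinearizedAction (p ^ m) ι ρ ∧ (ρ t).Monic ∧
        (ρ t).natDegree = D ∧ (∀ a, (ρ a).natDegree ≤ d a) ∧ (ρ t).coeff n = c}).Finite :=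
    Set.Finite.pi fun n => finite_coeff hfin hm hι hD1 hD d n
  refine Set.Finite.of_finite_image (f := fun ρ (n : Fin (D + 1)) => (ρ t).coeff n)
    (hT.subset ?_) ?_
  · rintro _ ⟨ρ, hρ, rfl⟩ n -
    exact ⟨ρ, hρ.1, hρ.2.1, hρ.2.2.1, hρ.2.2.2, rfl⟩
  · intro ρ hρ ρ' hρ' heq
    refine hρ.1.eq_of_eq hm hρ'.1 ht ?_
    ext n
    rcases lt_or_ge n (D + 1) with hn | hn
    · exact congrFun heq ⟨n, hn⟩
    · rw [coeff_eq_zero_of_natDegree_lt (by rw [hρ.2.2.1]; omega),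
        coeff_eq_zero_of_natDegree_lt (by rw [hρ'.2.2.1]; omega)]

end IsLinearizedAction

/-! ### Torsion of bounded degree -/

section Valuation

variable {F K : Type*} [Field F] [Field K] {θ : F[X] →+* K}

theorem ValuationSubring.mem_of_isIntegralElem {R : Type*} [CommRing R] {f : R →+* K}
    (W : ValuationSubring K) (hf : ∀ r, f r ∈ W) {x : K} (hx : f.IsIntegralElem x) : x ∈ W := by
  obtain ⟨g, hg, hgx⟩ := hx
  have hx : IsIntegral W x := by
    refine ⟨g.map (f.codRestrict W hf), hg.map _, ?_⟩
    rw [eval₂_map]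
    exact hgx
  obtain ⟨y, rfl⟩ := IsIntegrallyClosed.isIntegral_iff.1 hx
  exact y.2

/-- This supplies a place of `K` above a prime of `F[X]` at which the finitely many given elements
are integral. -/
theorem exists_valuationSubring_of_finset (hθ : Function.Injective θ) (S : Finset K)
    (hS : ∀ x : K, ∃ y ≠ 0, θ.IsIntegralElem (θ y * x)) :
    ∃ (π : F[X]) (W : ValuationSubring K), Irreducible π ∧ (∀ g, θ g ∈ W) ∧
      (∀ g, W.valuation (θ g) < 1 ↔ π ∣ g) ∧ ∀ x ∈ S, x ∈ W := by
  choose y hy0 hy using hS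
  -- Euclid's trick: a prime factor of `X * e + 1` divides none of the denominators `y x`.
  set e : F[X] := ∏ x ∈ S, y x with he
  have he0 : e ≠ 0 := Finset.prod_ne_zero_iff.2 fun x _ => hy0 x
  have hdeg : (X * e + 1).natDegree = e.natDegree + 1 := by
    rw [natDegree_add_eq_left_of_natDegree_lt] <;> rw [natDegree_X_mul he0]
    simp
  obtain ⟨π, hπ, hπe⟩ := WfDvdMonoid.exists_irreducible_factor (a := X * e + 1)
    (fun hu => by rw [natDegree_eq_zero_of_isUnit hu] at hdeg; omega)
    (fun h0 => by rw [h0, natDegree_zero] at hdeg; omega)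
  have hmem : ∀ g, θ g ∈ θ.range := fun g => ⟨g, rfl⟩
  set I : Ideal θ.range := (Ideal.span {π}).map θ.rangeRestrict with hI
  have hI1 : I ≠ ⊤ := by
    rw [Ideal.ne_top_iff_one]
    intro h1
    obtain ⟨g, hg, hg1⟩ := (Ideal.mem_map_iff_of_surjective _ θ.rangeRestrict_surjective).1 h1
    have : g = 1 := hθ (by rw [map_one]; exact congrArg Subtype.val hg1)
    rw [this, Ideal.mem_span_singleton] at hg
    exact hπ.not_isUnit (isUnit_of_dvd_one hg)
  obtain ⟨W, hW, hIW⟩ := Ideal.image_subset_nonunits_valuationSubring I hI1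
  have hθW : ∀ g, θ g ∈ W := fun g => hW (hmem g)
  have hπW : W.valuation (θ π) < 1 := by
    have : θ π ∈ W.nonunits :=
      hIW ⟨θ.rangeRestrict π, Ideal.mem_map_of_mem _ (Ideal.mem_span_singleton_self π), rfl⟩
    exact this
  have hdvd : ∀ g, W.valuation (θ g) < 1 ↔ π ∣ g := by
    intro g
    refine ⟨fun hg => ?_, ?_⟩
    · by_contra h
      obtain ⟨a, b, hab⟩ := (hπ.coprime_iff_not_dvd).2 h
      have h1 : W.valuation (θ (a * π + b * g)) < 1 := by
        rw [map_add, map_mul, map_mul]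
        refine (W.valuation.map_add_lt ?_ ?_) <;> rw [map_mul]
        · exact mul_lt_one_of_nonneg_of_lt_one_right ((W.valuation_le_one_iff _).2 (hθW a)) zero_le hπW
        · exact mul_lt_one_of_nonneg_of_lt_one_right ((W.valuation_le_one_iff _).2 (hθW b)) zero_le hg
      rw [hab, map_one, map_one] at h1
      exact lt_irrefl _ h1
    · rintro ⟨r, rfl⟩
      rw [map_mul, map_mul]
      exact mul_lt_one_of_nonneg_of_lt_one_left zero_le hπW ((W.valuation_le_one_iff _).2 (hθW r))
  refine ⟨π, W, hπ, hθW, hdvd, fun x hx => ?_⟩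
  have hyx : W.valuation (θ (y x)) = 1 := by
    refine le_antisymm ((W.valuation_le_one_iff _).2 (hθW _)) (not_lt.1 fun hlt => ?_)
    have h1 : π ∣ e := ((hdvd _).1 hlt).trans (Finset.dvd_prod_of_mem y hx)
    exact hπ.not_isUnit (isUnit_of_dvd_one ((dvd_add_right (h1.mul_left X)).1 hπe))
  have := (W.valuation_le_one_iff _).2 (W.mem_of_isIntegralElem hθW (hy x))
  rw [map_mul, hyx, one_mul] at this
  exact (W.valuation_le_one_iff _).1 this

theorem Polynomial.finite_setOf_natDegree_le_coeff_mem {R : Type*} [Semiring R] {C : Set R}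
    (hC : C.Finite) (N : ℕ) : {f : R[X] | f.natDegree ≤ N ∧ ∀ n, f.coeff n ∈ C}.Finite := by
  refine Set.Finite.of_finite_image (f := fun f (n : Fin (N + 1)) => f.coeff n)
    ((Set.Finite.pi (t := fun _ => C) fun _ => hC).subset ?_) ?_
  · rintro _ ⟨f, hf, rfl⟩ n -
    exact hf.2 n
  · intro f hf g hg heq
    ext n
    rcases lt_or_ge n (N + 1) with hn | hn
    · exact congrFun heq ⟨n, hn⟩
    · rw [coeff_eq_zero_of_natDegree_lt (hf.1.trans_lt hn),
        coeff_eq_zero_of_natDegree_lt (hg.1.trans_lt hn)]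

/-- The residues of integral elements of bounded degree over `F(X)` form a finite set. -/
theorem finite_residue_of_natDegree_le [Finite F] (hθ : Function.Injective θ) {π : F[X]}
    {W : ValuationSubring K} (hπ : Irreducible π) (hW : ∀ g, θ g ∈ W)
    (hπW : ∀ g, W.valuation (θ g) < 1 ↔ π ∣ g) (N : ℕ) :
    {z : IsLocalRing.ResidueField W | ∃ x : W, IsLocalRing.residue W x = z ∧
      ∃ P : F[X][X], P ≠ 0 ∧ P.natDegree ≤ N ∧ P.eval₂ θ x = 0}.Finite := by
  classical
  let _ := UniqueFactorizationMonoid.toNormalizedGCDMonoid F[X]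
  let θW : F[X] →+* W := θ.codRestrict W hW
  let θk : F[X] →+* IsLocalRing.ResidueField W := (IsLocalRing.residue W).comp θW
  have hker : ∀ g, θk g = 0 ↔ π ∣ g := by
    intro g
    rw [← hπW]
    change IsLocalRing.residue W (θW g) = 0 ↔ W.valuation (θW g : K) < 1
    rw [IsLocalRing.residue_eq_zero_iff, W.valuation_lt_one_iff]
  have hC : (Set.range θk).Finite := by
    have h1 : {f : F[X] | f.natDegree ≤ π.natDegree ∧ ∀ n, f.coeff n ∈ Set.univ}.Finite :=
      finite_setOf_natDegree_le_coeff_mem Set.finite_univ _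
    refine (h1.image θk).subset ?_
    rintro _ ⟨g, rfl⟩
    refine ⟨g % π, ⟨natDegree_le_natDegree (EuclideanDomain.mod_lt g hπ.ne_zero).le,
      fun n => trivial⟩, ?_⟩
    rw [← sub_eq_zero, ← map_sub, hker]
    exact ⟨-(g / π), by linear_combination EuclideanDomain.div_add_mod g π⟩
  have hC' : {f : (IsLocalRing.ResidueField W)[X] | (f.natDegree ≤ N ∧
      ∀ n, f.coeff n ∈ Set.range θk) ∧ f ≠ 0}.Finite :=
    (finite_setOf_natDegree_le_coeff_mem hC N).subset fun f hf => hf.1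
  refine Set.Finite.subset (hC'.biUnion (t := fun f => {z | f.IsRoot z})
    fun f hf => finite_setOfPred_isRoot hf.2) ?_
  rintro _ ⟨x, rfl, P, hP0, hPN, hPx⟩
  simp only [Set.mem_iUnion]
  -- Dividing by the content keeps the reduction modulo `π` nonzero; only finitely many reductions
  -- of bounded degree exist, as `F[X]/π` is finite.
  refine ⟨P.primPart.map θk, ⟨⟨(natDegree_map_le).trans (P.natDegree_primPart.trans_le hPN),
    fun n => ⟨P.primPart.coeff n, by rw [coeff_map]⟩⟩, fun h0 => ?_⟩, ?_⟩
  · refine hπ.not_isUnit (P.isPrimitive_primPart π ((C_dvd_iff_dvd_coeff _ _).2 fun n => ?_))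
    rw [← hker, ← coeff_map, h0, coeff_zero]
  · have h1 : eval₂ θW x P.primPart = 0 := by
      apply W.subtype_injective
      rw [hom_eval₂, map_zero]
      exact eval₂_primPart_eq_zero hθ hP0 hPx
    change IsRoot _ _
    rw [IsRoot.def, eval_map, ← hom_eval₂, h1, map_zero]

end Valuation

namespace IsLinearizedAction

variable {F A K : Type*} [Field F] [CommRing A] [Algebra F A] [Field K] {q : ℕ}
  {ι : A →+* K} {ρ : A → K[X]} {t : A} {W : ValuationSubring K}

theorem eval_sum (h : IsLinearizedAction q ι ρ) {I : Type*} (s : Finset I)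
    (b : I → A) (x : K) : (ρ (∑ i ∈ s, b i)).eval x = ∑ i ∈ s, (ρ (b i)).eval x := by
  classical
  induction s using Finset.induction_on with
  | empty => simp [h.zero]
  | insert i s hi ih => rw [Finset.sum_insert hi, Finset.sum_insert hi, h.add, eval_add, ih]

theorem eval_mem_valuationSubring (h : IsLinearizedAction q ι ρ)
    (hF : ∀ c : F, ρ (algebraMap F A c) = C (ι (algebraMap F A c)) * X)
    (hW : ∀ g : F[X], ι (aeval t g) ∈ W) (ht : ∀ n, (ρ t).coeff n ∈ W) (g : F[X]) :
    ∀ x ∈ W, (ρ (aeval t g)).eval x ∈ W := by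
  induction g using Polynomial.induction_on' with
  | add f g hf hg =>
    intro x hx
    rw [map_add, h.add, eval_add]
    exact W.add_mem _ _ (hf x hx) (hg x hx)
  | monomial n c =>
    intro x hx
    have hc : ι (algebraMap F A c) ∈ W := by simpa using hW (C c)
    rw [aeval_monomial, h.eval_mul, hF]
    simp only [Polynomial.eval_mul, eval_C, eval_X]
    refine W.mul_mem _ _ hc ?_
    induction n with
    | zero => simpa [h.one] using hx
    | succ n ih =>
      rw [pow_succ', h.eval_mul, eval_eq_sum]
      exact sum_mem fun i _ => W.mul_mem _ _ (ht i) (pow_mem ih i)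

/-- Near `0` the action is approximately multiplication by its linear coefficient. So nonzero
torsion whose order is a unit at `W` cannot reduce to `0`. -/
theorem exists_eval_eq_mul (hq : 1 < q) (h : IsLinearizedAction q ι ρ)
    (hF : ∀ c : F, ρ (algebraMap F A c) = C (ι (algebraMap F A c)) * X)
    (hW : ∀ g : F[X], ι (aeval t g) ∈ W) (ht : ∀ n, (ρ t).coeff n ∈ W) (g : F[X]) :
    ∀ x, W.valuation x < 1 → ∃ w, W.valuation w < 1 ∧
      (ρ (aeval t g)).eval x = (ι (aeval t g) + w) * x := by
  induction g using Polynomial.induction_on' with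
  | add f g hf hg =>
    intro x hx
    obtain ⟨w, hw, hfx⟩ := hf x hx
    obtain ⟨w', hw', hgx⟩ := hg x hx
    refine ⟨w + w', W.valuation.map_add_lt hw hw', ?_⟩
    rw [map_add, h.add, eval_add, hfx, hgx, map_add]
    ring
  | monomial n c =>
    intro x hx
    have hc : W.valuation (ι (algebraMap F A c)) ≤ 1 :=
      (W.valuation_le_one_iff _).2 (by simpa using hW (C c))
    have htn : ∀ n, W.valuation (ι (t ^ n)) ≤ 1 := fun n =>
      (W.valuation_le_one_iff _).2 (by simpa using hW (X ^ n))
    suffices ∃ w, W.valuation w < 1 ∧ (ρ (t ^ n)).eval x = (ι (t ^ n) + w) * x by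
      obtain ⟨w, hw, hwx⟩ := this
      refine ⟨ι (algebraMap F A c) * w, ?_, ?_⟩
      · rw [map_mul]
        exact mul_lt_one_of_nonneg_of_lt_one_right hc zero_le hw
      · rw [aeval_monomial, h.eval_mul, hF, hwx, map_mul]
        simp only [Polynomial.eval_mul, eval_C, eval_X]
        ring
    induction n with
    | zero => exact ⟨0, by simp, by simp [h.one]⟩
    | succ n ih =>
      obtain ⟨w, hw, hwx⟩ := ih
      set y := (ρ (t ^ n)).eval x with hy
      have hyv : W.valuation y < 1 := by
        rw [hwx, map_mul]
        exact mul_lt_one_of_nonneg_of_lt_one_right (W.valuation.map_add_le (htn n) hw.le) zero_le hx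
      set s := (ρ t).divX.divX.eval y with hs
      have hsW : W.valuation s ≤ 1 := by
        rw [W.valuation_le_one_iff, hs, eval_eq_sum]
        refine sum_mem fun i _ => W.mul_mem _ _ ?_
          (pow_mem ((W.valuation_le_one_iff _).1 hyv.le) i)
        rw [coeff_divX, coeff_divX]
        exact ht _
      have hty : (ρ t).eval y = (ι t + y * s) * y := by
        conv_lhs => rw [← divX_mul_X_add (ρ t), ← divX_mul_X_add (ρ t).divX]
        rw [(h.isLinearized t).coeff_zero hq, coeff_divX, zero_add,
          h.coeff_one]
        simp only [eval_add, Polynomial.eval_mul, eval_C, eval_X]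
        ring
      refine ⟨ι t * w + y * s * (ι (t ^ n) + w), ?_, ?_⟩
      · refine W.valuation.map_add_lt ?_ ?_
        · rw [map_mul]
          exact mul_lt_one_of_nonneg_of_lt_one_right (by simpa using htn 1) zero_le hw
        · rw [map_mul, map_mul]
          exact mul_lt_one_of_nonneg_of_lt_one_left zero_le
            (mul_lt_one_of_nonneg_of_lt_one_left zero_le hyv hsW)
            (W.valuation.map_add_le (htn n) hw.le)
      · rw [pow_succ', h.eval_mul, ← hy, hty, map_mul]
        linear_combination (ι t + y * s) * hwx

/-- If `x` had valuation above `1`, iterating the monic `ρ_t` would make the valuations grow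
strictly, and the top term of `ρ_f(x)` could not cancel. -/
theorem mem_valuationSubring_of_eval_eq_zero (h : IsLinearizedAction q ι ρ)
    (hF : ∀ c : F, ρ (algebraMap F A c) = C (ι (algebraMap F A c)) * X)
    (hW : ∀ g : F[X], ι (aeval t g) ∈ W) (ht : ∀ n, (ρ t).coeff n ∈ W) (hmonic : (ρ t).Monic)
    (hdeg : 1 < (ρ t).natDegree) {f : F[X]} (hf : f.Monic) {x : K}
    (hx : (ρ (aeval t f)).eval x = 0) : x ∈ W := by
  by_contra hxW
  rw [← W.valuation_le_one_iff, not_le] at hxW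
  set y : ℕ → K := fun n => (ρ (t ^ n)).eval x with hy
  have hsucc : ∀ n, 1 < W.valuation (y n) →
      W.valuation (y (n + 1)) = W.valuation (y n) ^ (ρ t).natDegree := by
    intro n hn
    have h0 : W.valuation (y n) ≠ 0 := (one_pos.trans hn).ne'
    have : y (n + 1) = (ρ t).eval (y n) := by
      simp only [hy]
      rw [pow_succ', h.eval_mul]
    rw [this, eval_eq_sum_range, Valuation.map_sum_eq_of_lt (j := (ρ t).natDegree) _ (by simp)]
    · rw [coeff_natDegree, hmonic.leadingCoeff, one_mul, map_pow]
    · intro i hi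
      obtain ⟨hi, hne⟩ := Finset.mem_sdiff.1 hi
      rw [Finset.mem_range] at hi
      rw [Finset.mem_singleton] at hne
      rw [coeff_natDegree, hmonic.leadingCoeff, one_mul, map_mul, map_pow, map_pow]
      refine lt_of_le_of_lt (mul_le_of_le_one_left' ((W.valuation_le_one_iff _).2 (ht i))) ?_
      exact pow_lt_pow_right₀ hn (by omega)
  have hgt : ∀ n, 1 < W.valuation (y n) := by
    intro n
    induction n with
    | zero => simpa [hy, h.one] using hxW
    | succ n ih =>
      rw [hsucc n ih]
      exact one_lt_pow₀ ih (by omega)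
  have hmono : StrictMono fun n => W.valuation (y n) := strictMono_nat_of_lt_succ fun n => by
    rw [hsucc n (hgt n)]
    exact lt_self_pow₀ (hgt n) hdeg
  have hsum : (ρ (aeval t f)).eval x =
      ∑ i ∈ Finset.range (f.natDegree + 1), ι (algebraMap F A (f.coeff i)) * y i := by
    rw [aeval_eq_sum_range, h.eval_sum]
    refine Finset.sum_congr rfl fun i _ => ?_
    rw [Algebra.smul_def, h.eval_mul, hF]
    simp [hy]
  have hlead : W.valuation (ι (algebraMap F A (f.coeff f.natDegree)) * y f.natDegree) =
      W.valuation (y f.natDegree) := by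
    rw [coeff_natDegree, hf.leadingCoeff, map_one, map_one, one_mul]
  have : W.valuation ((ρ (aeval t f)).eval x) = W.valuation (y f.natDegree) := by
    rw [hsum, Valuation.map_sum_eq_of_lt (j := f.natDegree) _ (by simp), hlead]
    intro i hi
    obtain ⟨hi, hne⟩ := Finset.mem_sdiff.1 hi
    rw [Finset.mem_range] at hi
    rw [Finset.mem_singleton] at hne
    rw [hlead, map_mul]
    refine lt_of_le_of_lt (mul_le_of_le_one_left' ((W.valuation_le_one_iff _).2 ?_))
      (hmono (by omega : i < f.natDegree))
    simpa using hW (C (f.coeff i))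
  rw [hx, map_zero] at this
  exact absurd (hgt f.natDegree) (by rw [← this]; exact not_lt.2 zero_le_one)

/-- For a fixed action, torsion of prime order whose multiples have bounded degree over `F(X)` has
order in a finite set of primes. -/
theorem finite_setOf_irreducible [Finite F] (hq : 1 < q) (h : IsLinearizedAction q ι ρ)
    (hF : ∀ c : F, ρ (algebraMap F A c) = C (ι (algebraMap F A c)) * X)
    (hmonic : (ρ t).Monic) (hdeg : 1 < (ρ t).natDegree)
    {θ : F[X] →+* K} (hθ : Function.Injective θ) (hθt : ∀ g, θ g = ι (aeval t g))
    (hint : ∀ x : K, ∃ y ≠ 0, θ.IsIntegralElem (θ y * x)) (N : ℕ) :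
    {f : F[X] | f.Monic ∧ Irreducible f ∧ ∃ x ≠ 0, (ρ (aeval t f)).eval x = 0 ∧
      ∀ g : F[X], ∃ P : F[X][X], P ≠ 0 ∧ P.natDegree ≤ N ∧
        P.eval₂ θ ((ρ (aeval t g)).eval x) = 0}.Finite := by
  classical
  obtain ⟨π, W, hπ, hθW, hπW, ht'⟩ := exists_valuationSubring_of_finset hθ
    ((Finset.range ((ρ t).natDegree + 1)).image (ρ t).coeff) hint
  have ht : ∀ n, (ρ t).coeff n ∈ W := by
    intro n
    rcases lt_or_ge n ((ρ t).natDegree + 1) with hn | hn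
    · exact ht' _ (Finset.mem_image_of_mem _ (Finset.mem_range.2 hn))
    · rw [coeff_eq_zero_of_natDegree_lt hn]
      exact W.zero_mem
  have hW : ∀ g : F[X], ι (aeval t g) ∈ W := fun g => hθt g ▸ hθW g
  have hT := finite_residue_of_natDegree_le hθ hπ hθW hπW N
  set T := {z : IsLocalRing.ResidueField W | ∃ x : W, IsLocalRing.residue W x = z ∧
      ∃ P : F[X][X], P ≠ 0 ∧ P.natDegree ≤ N ∧ P.eval₂ θ x = 0} with hTdef
  have := hT.to_subtype
  -- If `f` is prime to `π`, its degree is bounded by the number of residues; otherwise `f` is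
  -- associated to `π`.
  refine (((finite_setOf_natDegree_le_coeff_mem (Set.finite_univ (α := F)) (Nat.card T)).union
    (finite_setOf_natDegree_le_coeff_mem (Set.finite_univ (α := F)) π.natDegree))).subset ?_
  rintro f ⟨hf, hirr, x, hx0, hfx, hdegx⟩
  by_cases hπf : π ∣ f
  · right
    exact ⟨natDegree_le_of_dvd ((hπ.dvd_symm hirr) hπf) hπ.ne_zero, fun n => trivial⟩
  left
  refine ⟨?_, fun n => trivial⟩
  have hfv : W.valuation (ι (aeval t f)) = 1 := by
    rw [← hθt]
    exact le_antisymm ((W.valuation_le_one_iff _).2 (hθW f)) (not_lt.1 (mt (hπW f).1 hπf))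
  have hunit : ∀ y, y ≠ 0 → (ρ (aeval t f)).eval y = 0 → W.valuation y = 1 := by
    intro y hy0 hy
    refine le_antisymm ((W.valuation_le_one_iff _).2
      (h.mem_valuationSubring_of_eval_eq_zero hF hW ht hmonic hdeg hf hy)) (not_lt.1 fun hlt => ?_)
    obtain ⟨w, hw, hwy⟩ := h.exists_eval_eq_mul hq hF hW ht f y hlt
    rw [hy, eq_comm, mul_eq_zero, or_iff_left hy0, add_eq_zero_iff_eq_neg] at hwy
    rw [hwy, Valuation.map_neg] at hfv
    exact hw.ne hfv
  have hxW : x ∈ W := (W.valuation_le_one_iff _).1 (hunit x hx0 hfx).le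
  have hgx : ∀ g : F[X], ¬ f ∣ g → W.valuation ((ρ (aeval t g)).eval x) = 1 := by
    intro g hg
    refine hunit _ (fun h0 => ?_) ?_
    · obtain ⟨a, b, hab⟩ := (hirr.coprime_iff_not_dvd).2 hg
      have h1 : (ρ (aeval t (a * f + b * g))).eval x = 0 := by
        rw [map_add, h.add, eval_add, map_mul, map_mul, h.eval_mul, h.eval_mul, hfx, h0,
          h.eval_zero hq,
          h.eval_zero hq, add_zero]
      rw [hab, map_one, h.one, eval_X] at h1
      exact hx0 h1
    · rw [← h.eval_mul, mul_comm, h.eval_mul, hfx,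
        h.eval_zero hq]
  -- The multiples of `x` by the residues modulo `f` stay distinct after reduction, which gives `#F
  -- ^ deg f ≤ #T`.
  have hinj : Function.Injective fun g : degreeLT F f.natDegree =>
      (⟨IsLocalRing.residue W ⟨_, h.eval_mem_valuationSubring hF hW ht g x hxW⟩,
        ⟨_, h.eval_mem_valuationSubring hF hW ht g x hxW⟩, rfl, hdegx g⟩ : T) := by
    intro g g' hgg
    have h1 := congrArg Subtype.val hgg
    simp only at h1
    rw [← sub_eq_zero, ← map_sub, IsLocalRing.residue_eq_zero_iff, W.valuation_lt_one_iff] at h1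
    have h2 : (ρ (aeval t (g : F[X]))).eval x - (ρ (aeval t (g' : F[X]))).eval x =
        (ρ (aeval t ((g : F[X]) - (g' : F[X])))).eval x := by
      rw [map_sub, h.sub, Polynomial.eval_sub]
    change W.valuation ((ρ (aeval t (g : F[X]))).eval x - (ρ (aeval t (g' : F[X]))).eval x) < 1 at h1
    rw [h2] at h1
    by_contra hne
    have hnd : ¬ f ∣ (g : F[X]) - (g' : F[X]) := by
      intro hd
      refine hne (Subtype.ext (sub_eq_zero.1 (eq_zero_of_dvd_of_degree_lt hd ?_)))
      rw [degree_eq_natDegree hf.ne_zero]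
      exact mem_degreeLT.1 (sub_mem g.2 g'.2)
    exact h1.ne (hgx _ hnd)
  have hcard := Nat.card_le_card_of_injective _ hinj
  rw [Nat.card_congr (degreeLTEquiv F f.natDegree).toEquiv, Nat.card_fun, Nat.card_fin] at hcard
  exact ((Nat.lt_pow_self (Finite.one_lt_card (α := F))).trans_le hcard).le

end IsLinearizedAction

/-! ### Degrees over a rational function field -/

section FunctionField

variable {F K L : Type*} [Field F] [Field K] [Algebra F K] [Algebra (RatFunc F) K]
  [IsScalarTower F (RatFunc F) K] [FunctionField F K]

theorem FunctionField.trdeg_eq_one : Algebra.trdeg F K = 1 := by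
  have h1 := lift_trdeg_add_eq F F[X] (RatFunc F)
  have : Algebra.IsAlgebraic F[X] (RatFunc F) :=
    IsLocalization.isAlgebraic (RatFunc F) (nonZeroDivisors F[X])
  rw [Polynomial.trdeg_of_isDomain, trdeg_eq_zero] at h1
  have h2 := lift_trdeg_add_eq F (RatFunc F) K
  have : Module.Finite (RatFunc F) K := ‹FunctionField F K›
  rw [trdeg_eq_zero (R := RatFunc F) (A := K)] at h2
  simp only [Cardinal.lift_one, Cardinal.lift_zero, add_zero] at h1 h2
  have h3 : Algebra.trdeg F (RatFunc F) = 1 := by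
    rw [← Cardinal.lift_inj, ← h1, Cardinal.lift_one]
  rw [h3, Cardinal.lift_one] at h2
  rw [← Cardinal.lift_inj, ← h2, Cardinal.lift_one]

/-- `K` is finitely generated of transcendence degree 1 over `F`, hence finite over `F(t)`. The
bound is `[L : F(t)]`, with denominators cleared from minimal polynomials. -/
theorem FunctionField.exists_natDegree_le {t : K} (ht : Transcendental F t) [Field L] [Algebra K L]
    [FiniteDimensional K L] :
    ∃ N : ℕ, ∀ y : L, ∃ P : F[X][X], P ≠ 0 ∧ P.natDegree ≤ N ∧
      P.eval₂ ((algebraMap K L).comp (aeval t : F[X] →ₐ[F] K).toRingHom) y = 0 := by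
  let _ : Algebra F[X] K := (aeval t : F[X] →ₐ[F] K).toRingHom.toAlgebra
  have hmap : ∀ g : F[X], algebraMap F[X] K g = aeval t g := fun g => rfl
  have hinj : Function.Injective (algebraMap F[X] K) :=
    transcendental_iff_injective.1 ht
  have : FaithfulSMul F[X] K := (faithfulSMul_iff_algebraMap_injective _ _).2 hinj
  have : IsScalarTower F F[X] K := IsScalarTower.of_algebraMap_eq fun c => by simp [hmap]
  have hK : Module.Finite (RatFunc F) K := ‹FunctionField F K›
  have halg : Algebra.IsAlgebraic F[X] K := by
    rw [← trdeg_eq_zero_iff]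
    have h1 := lift_trdeg_add_eq F F[X] K
    rw [Polynomial.trdeg_of_isDomain, FunctionField.trdeg_eq_one, Cardinal.lift_one,
      Cardinal.lift_one] at h1
    have h2 : Cardinal.lift (Algebra.trdeg F[X] K) = 0 :=
      Cardinal.eq_of_add_eq_add_left (a := 1) (by rw [add_zero]; exact h1) Cardinal.one_lt_aleph0
    exact Cardinal.lift_eq_zero.1 h2
  have hess : Algebra.EssFiniteType F K := by
    have h1 : Algebra.EssFiniteType F[X] (RatFunc F) :=
      Algebra.EssFiniteType.of_isLocalization _ (nonZeroDivisors F[X])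
    have h2 : Algebra.EssFiniteType F (RatFunc F) := Algebra.EssFiniteType.comp F F[X] (RatFunc F)
    exact Algebra.EssFiniteType.comp F (RatFunc F) K
  let _ := FractionRing.liftAlgebra F[X] K
  have : IsScalarTower F[X] (FractionRing F[X]) K := inferInstance
  have : IsScalarTower F (FractionRing F[X]) K := IsScalarTower.of_algebraMap_eq fun c => by
    rw [IsScalarTower.algebraMap_apply F F[X] K, IsScalarTower.algebraMap_apply F F[X]
      (FractionRing F[X]), ← IsScalarTower.algebraMap_apply F[X] (FractionRing F[X]) K]
  have hess' : Algebra.EssFiniteType (FractionRing F[X]) K :=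
    Algebra.EssFiniteType.of_comp F (FractionRing F[X]) K
  have halg' : Algebra.IsAlgebraic (FractionRing F[X]) K :=
    Algebra.IsAlgebraic.extendScalars (IsFractionRing.injective F[X] (FractionRing F[X]))
  have hfin : FiniteDimensional (FractionRing F[X]) K := by
    obtain ⟨S, hS⟩ := IntermediateField.fg_top (FractionRing F[X]) K
    have h1 : FiniteDimensional (FractionRing F[X])
        (IntermediateField.adjoin (FractionRing F[X]) (S : Set K)) :=
      IntermediateField.finiteDimensional_adjoin fun x _ =>
        (Algebra.IsAlgebraic.isAlgebraic x).isIntegral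
    rw [hS] at h1
    exact Module.Finite.equiv IntermediateField.topEquiv.toLinearEquiv
  let _ : Algebra (FractionRing F[X]) L :=
    ((algebraMap K L).comp (algebraMap (FractionRing F[X]) K)).toAlgebra
  have : IsScalarTower (FractionRing F[X]) K L := IsScalarTower.of_algebraMap_eq fun _ => rfl
  have : FiniteDimensional (FractionRing F[X]) L := FiniteDimensional.trans _ K L
  let _ : Algebra F[X] L := ((algebraMap K L).comp (algebraMap F[X] K)).toAlgebra
  have : IsScalarTower F[X] (FractionRing F[X]) L := IsScalarTower.of_algebraMap_eq fun g => by
    change algebraMap K L (algebraMap F[X] K g) =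
      algebraMap K L (algebraMap (FractionRing F[X]) K (algebraMap F[X] (FractionRing F[X]) g))
    rw [← IsScalarTower.algebraMap_apply F[X] (FractionRing F[X]) K]
  refine ⟨Module.finrank (FractionRing F[X]) L, fun y =>
    ⟨IsLocalization.integerNormalization (nonZeroDivisors F[X]) (minpoly (FractionRing F[X]) y),
      ?_, ?_, ?_⟩⟩
  · rw [Ne, IsLocalization.integerNormalization_eq_zero_iff le_rfl]
    exact minpoly.ne_zero (Algebra.IsIntegral.isIntegral y)
  · refine le_trans ?_ (minpoly.natDegree_le y)
    exact natDegree_le_natDegree (degree_mono (IsLocalization.integerNormalization_support _ _))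
  · exact IsLocalization.integerNormalization_aeval_eq_zero (nonZeroDivisors F[X])
      (minpoly (FractionRing F[X]) y) (minpoly.aeval _ _)

end FunctionField

/-! ### The ring of regular functions -/

/-- A nonzero ideal is finite modulo any nonzero principal ideal inside it, so the ring is
noetherian; a nonzero prime is maximal because finite domains are fields. -/
theorem isDedekindDomain_of_finite_quotient {A K : Type*} [CommRing A] [IsDomain A] [Field K]
    [Algebra A K] (hinj : Function.Injective (algebraMap A K))
    (hfin : ∀ I : Ideal A, I ≠ ⊥ → Finite (A ⧸ I))
    (hint : ∀ x : K, IsIntegral A x → ∃ a, algebraMap A K a = x) : IsDedekindDomain A := by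
  have hnoeth : IsNoetherianRing A := by
    refine ⟨fun I => ?_⟩
    rcases eq_or_ne I ⊥ with rfl | hI
    · exact Submodule.fg_bot
    obtain ⟨a, ha, ha0⟩ := Submodule.exists_mem_ne_zero_of_ne_bot hI
    have := hfin (Ideal.span {a}) (by simpa using ha0)
    refine Submodule.fg_of_fg_map_of_fg_inf_ker (Submodule.mkQ (Ideal.span {a})) ?_ ?_
    · have := Module.Finite.of_finite (R := A) (M := A ⧸ Ideal.span {a})
      exact IsNoetherian.noetherian _
    · rw [Submodule.ker_mkQ, inf_eq_right.2 ((Ideal.span_singleton_le_iff_mem I).2 ha)]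
      exact ⟨{a}, by simp [Ideal.span]⟩
  have hdim : Ring.DimensionLEOne A := ⟨fun {p} hp hprime => by
    have := hfin p hp
    exact Ideal.Quotient.maximal_of_isField p (Finite.isField_of_domain _)⟩
  have hic : IsIntegrallyClosed A := by
    rw [isIntegrallyClosed_iff (FractionRing A)]
    intro x hx
    let j : FractionRing A →ₐ[A] K := IsFractionRing.liftAlgHom (g := Algebra.ofId A K) hinj
    obtain ⟨a, ha⟩ := hint (j x) (hx.map j)
    exact ⟨a, j.toRingHom.injective (by simpa using ha)⟩
  exact { }

theorem FunctionFieldPlace.isDedekindDomain {F K : Type*} [Field F] [Field K] [Algebra F K]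
    (P : FunctionFieldPlace F K)
    (hfin : ∀ I : Ideal P.regularAway, I ≠ ⊥ → Finite (P.regularAway ⧸ I)) :
    IsDedekindDomain P.regularAway := by
  refine isDedekindDomain_of_finite_quotient (K := K) Subtype.val_injective hfin fun x hx => ?_
  refine ⟨⟨x, fun Q hQ => ?_⟩, rfl⟩
  exact Q.ring.mem_of_isIntegralElem (f := algebraMap P.regularAway K) (fun r => r.2 Q hQ) hx

/-! ### Finiteness of the set of rank one Drinfeld modules with torsion -/

theorem FiniteField.exists_card_eq_pow (F : Type*) [Field F] [Finite F] :
    ∃ p m : ℕ, p.Prime ∧ m ≠ 0 ∧ CharP F p ∧ Nat.card F = p ^ m := by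
  have := Fintype.ofFinite F
  obtain ⟨p, hp⟩ := CharP.exists F
  obtain ⟨n, hn, hc⟩ := FiniteField.card F p
  exact ⟨p, n, hn, n.ne_zero, hp, by rw [Nat.card_eq_fintype_card, hc]⟩

theorem Ideal.pow_ne_one_of_card_quotient {A : Type*} [CommRing A] {t : A} {D n : ℕ} (hD1 : 1 < D)
    (hD : ∀ n, Nat.card (A ⧸ Ideal.span {t ^ n}) = D ^ n) (hn : n ≠ 0) : t ^ n ≠ 1 := by
  intro h
  have h1 := hD n
  have : Subsingleton (A ⧸ Ideal.span {t ^ n}) := by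
    rw [h, Ideal.span_singleton_one]
    exact Ideal.Quotient.subsingleton_iff.2 rfl
  rw [Nat.card_of_subsingleton (0 : A ⧸ Ideal.span {t ^ n})] at h1
  exact absurd h1 (Nat.one_lt_pow hn hD1).ne

/-- Were `t` algebraic over the finite field `F`, two of its powers would coincide. -/
theorem transcendental_of_pow_ne_one {F A : Type*} [Field F] [Finite F] [CommRing A] [IsDomain A]
    [Algebra F A] {t : A} (ht0 : t ≠ 0) (ht : ∀ n ≠ 0, t ^ n ≠ 1) : Transcendental F t := by
  rintro ⟨g, hg0, hg⟩
  have hmod : ∀ f : F[X], aeval t (f % g) = aeval t f := fun f => by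
    conv_rhs => rw [← EuclideanDomain.div_add_mod f g]
    rw [map_add, map_mul, hg, zero_mul, zero_add]
  have hfin : {f : F[X] | f.natDegree ≤ g.natDegree ∧ ∀ n, f.coeff n ∈ Set.univ}.Finite :=
    finite_setOf_natDegree_le_coeff_mem Set.finite_univ _
  obtain ⟨i, -, j, -, hij, h⟩ := Set.infinite_univ.exists_ne_map_eq_of_mapsTo
    (f := fun i : ℕ => (X ^ i % g : F[X])) (t := {f : F[X] | f.natDegree ≤ g.natDegree ∧
      ∀ n, f.coeff n ∈ Set.univ}) (fun i _ => ⟨natDegree_le_natDegree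
      (EuclideanDomain.mod_lt (X ^ i) hg0).le, fun n => trivial⟩) hfin
  replace h : t ^ i = t ^ j := by
    have h1 := congrArg (aeval t) h
    simpa only [hmod, map_pow, aeval_X] using h1
  wlog hlt : i < j generalizing i j
  · exact this j i hij.symm h.symm (by omega)
  refine ht (j - i) (by omega) (mul_left_cancel₀ (pow_ne_zero i ht0) ?_)
  rw [← pow_add, Nat.add_sub_cancel' hlt.le, mul_one, h]

theorem exists_isIntegralElem {R L E : Type*} [CommRing R] [IsDomain R] [Field L] [Field E]
    [Algebra L E] [Algebra.IsAlgebraic L E] {f : R →+* L} (hf : Function.Injective f)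
    (hL : ∀ y : L, ∃ P : R[X], P ≠ 0 ∧ P.eval₂ f y = 0) (x : E) :
    ∃ y ≠ 0, ((algebraMap L E).comp f).IsIntegralElem ((algebraMap L E).comp f y * x) := by
  let _ : Algebra R L := f.toAlgebra
  let _ : Algebra R E := ((algebraMap L E).comp f).toAlgebra
  have : IsScalarTower R L E := IsScalarTower.of_algebraMap_eq fun _ => rfl
  have : FaithfulSMul R L := (faithfulSMul_iff_algebraMap_injective _ _).2 hf
  have : Algebra.IsAlgebraic R L := ⟨hL⟩
  have : Algebra.IsAlgebraic R E := Algebra.IsAlgebraic.trans R L E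
  obtain ⟨y, hy0, hy⟩ := (Algebra.IsAlgebraic.isAlgebraic (R := R) x).exists_integral_multiple
  exact ⟨y, hy0, by rwa [Algebra.smul_def] at hy⟩

namespace IsLinearizedAction

variable {F A L : Type*} [Field F] [CommRing A] [Algebra F A] [Field L] {q : ℕ} {ι : A →+* L}
  {ρ : A → L[X]}

/-- Peel off irreducible factors of `f`: the last multiple of `x` before it vanishes is killed by a
single factor. -/
theorem exists_irreducible (hq : 1 < q) (h : IsLinearizedAction q ι ρ) (t : A) {f : F[X]}
    (hf : f ≠ 0) {x : L} (hx0 : x ≠ 0) (hx : (ρ (aeval t f)).eval x = 0) :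
    ∃ g : F[X], g.Monic ∧ Irreducible g ∧ ∃ y ≠ 0, (ρ (aeval t g)).eval y = 0 := by
  induction f using WfDvdMonoid.induction_on_irreducible with
  | zero => exact absurd rfl hf
  | unit u hu =>
    obtain ⟨v, hv⟩ := hu.exists_left_inv
    have h1 : (ρ (aeval t (v * u))).eval x = 0 := by
      rw [map_mul, h.eval_mul, hx, h.eval_zero hq]
    rw [hv, map_one, h.one, eval_X] at h1
    exact absurd h1 hx0
  | mul f i hf0 hi ih =>
    by_cases hy : (ρ (aeval t f)).eval x = 0
    · exact ih hf0 hy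
    refine ⟨i * C i.leadingCoeff⁻¹, monic_mul_leadingCoeff_inv hi.ne_zero,
      irreducible_mul_leadingCoeff_inv.2 hi, _, hy, ?_⟩
    rw [mul_comm i, ← h.eval_mul, ← map_mul, mul_assoc, map_mul, h.eval_mul, hx, h.eval_zero hq]

end IsLinearizedAction

namespace DrinfeldModule

variable {F A L : Type*} [Field F] [Finite F] [CommRing A] [Algebra F A] [Field L] [Algebra A L]

theorem isLinearizedAction (φ : DrinfeldModule F A L) :
    IsLinearizedAction (Nat.card F) (algebraMap A L) φ.poly where
  isLinearized := φ.support_poly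
  one := by simpa using φ.poly_algebraMap 1
  add := φ.poly_add
  mul := φ.poly_mul
  coeff_one := φ.coeff_one_poly

theorem exists_one_lt_natDegree (φ : DrinfeldModule F A L) : ∃ a, 1 < (φ.poly a).natDegree := by
  obtain ⟨a, ha⟩ := φ.nontrivial
  refine ⟨a, ?_⟩
  by_contra! h
  apply ha
  rw [eq_X_add_C_of_natDegree_le_one h, φ.coeff_one_poly,
    (φ.isLinearizedAction.isLinearized a).coeff_zero Finite.one_lt_card, C_0, add_zero]

theorem zero_mem_torsion [Nontrivial A] (φ : DrinfeldModule F A L) : (0 : L) ∈ φ.torsion :=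
  ⟨1, one_ne_zero, φ.isLinearizedAction.eval_zero Finite.one_lt_card 1⟩

theorem exists_ne_zero_of_torsion_ne [Nontrivial A] (φ : DrinfeldModule F A L)
    (h : φ.torsion ≠ {0}) : ∃ x ∈ φ.torsion, x ≠ 0 := by
  by_contra! h0
  exact h (Set.eq_singleton_iff_unique_mem.2 ⟨φ.zero_mem_torsion, h0⟩)

/-- `Nat.card` of an infinite type is `0`, while `φ_a` has positive degree; the rank condition
therefore forces `A/aA` to be finite. -/
theorem HasRank.finite_quotient [FaithfulSMul A L] {φ : DrinfeldModule F A L} (h : φ.HasRank 1)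
    {I : Ideal A} (hI : I ≠ ⊥) : Finite (A ⧸ I) := by
  obtain ⟨a, ha, ha0⟩ := Submodule.exists_mem_ne_zero_of_ne_bot hI
  have h1 := h a ha0
  have h2 : (φ.poly a).natDegree ≠ 0 := by
    have : 1 ≤ (φ.poly a).natDegree := le_natDegree_of_ne_zero (by
      rw [φ.coeff_one_poly, Ne, FaithfulSMul.algebraMap_eq_zero_iff]
      exact ha0)
    omega
  rw [h1, pow_one] at h2
  have := Nat.finite_of_card_ne_zero h2
  exact Finite.of_surjective _
    (Ideal.Quotient.factor_surjective ((Ideal.span_singleton_le_iff_mem I).2 ha))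

theorem HasRank.card_quotient_pow [IsDomain A] {φ : DrinfeldModule F A L} (h : φ.HasRank 1) {t : A}
    (ht : t ≠ 0) (n : ℕ) :
    Nat.card (A ⧸ Ideal.span {t ^ n}) = (φ.poly t).natDegree ^ n := by
  rw [← φ.isLinearizedAction.natDegree_pow, h _ (pow_ne_zero n ht), pow_one]

theorem isIso_of_scale_eq {φ ψ : DrinfeldModule F A L} {E : Type*} [Field E] [Algebra L E]
    {u v : Eˣ} {w : L} (hw0 : w ≠ 0) (hw : algebraMap L E w * u = v)
    (h : ∀ a, C (↑u⁻¹ : E) * ((φ.poly a).map (algebraMap L E)).comp (C (u : E) * X) =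
      C (↑v⁻¹ : E) * ((ψ.poly a).map (algebraMap L E)).comp (C (v : E) * X)) : IsIso φ ψ := by
  refine ⟨Units.mk0 w hw0, fun a => ?_⟩
  ext n
  rw [mul_comp, C_comp, X_comp, coeff_C_mul, comp_C_mul_X_coeff, Units.val_mk0]
  apply (algebraMap L E).injective
  have h1 := congrArg (fun f => f.coeff n) (h a)
  simp only [IsLinearizedAction.coeff_scale, coeff_map] at h1
  have hu := u.ne_zero
  have hv := v.ne_zero
  rw [Units.val_inv_eq_inv_val, Units.val_inv_eq_inv_val, ← hw] at h1
  have hw0' : algebraMap L E w ≠ 0 := by simpa using hw0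
  rw [map_mul, map_mul, map_pow]
  rw [mul_pow] at h1
  have hun : (u : E) ^ n ≠ 0 := pow_ne_zero n hu
  apply mul_right_cancel₀ hun
  field_simp at h1
  linear_combination (u : E) ^ n * h1

/-- Finiteness of rank one Drinfeld modules with torsion, given that `L` has bounded degree over the
subfield generated by an element `t` of `A` for which the quotients by powers of `t` are known. -/
theorem finite_setOf_torsion_ne [IsDedekindDomain A] [FaithfulSMul A L]
    (hfin : ∀ I : Ideal A, I ≠ ⊥ → Finite (A ⧸ I)) {t : A} {D N : ℕ} (ht0 : t ≠ 0) (hD1 : 1 < D)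
    (hD : ∀ n, Nat.card (A ⧸ Ideal.span {t ^ n}) = D ^ n)
    (hN : ∀ y : L, ∃ P : F[X][X], P ≠ 0 ∧ P.natDegree ≤ N ∧
      P.eval₂ ((algebraMap A L).comp (aeval t : F[X] →ₐ[F] A).toRingHom) y = 0) :
    {c : Quotient (isoSetoid F A L) | ∃ φ : DrinfeldModule F A L,
      Quotient.mk _ φ = c ∧ φ.HasRank 1 ∧ φ.torsion ≠ {0}}.Finite := by
  have ht1 : ∀ n ≠ 0, t ^ n ≠ 1 := fun n hn => Ideal.pow_ne_one_of_card_quotient hD1 hD hn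
  have htr : Transcendental F t := transcendental_of_pow_ne_one ht0 ht1
  have hinjA : Function.Injective (aeval t : F[X] →ₐ[F] A) := transcendental_iff_injective.1 htr
  have : Infinite A := Infinite.of_injective _ hinjA
  obtain ⟨p, m, hp, hm, hFp, hcard⟩ := FiniteField.exists_card_eq_pow F
  have : Fact p.Prime := ⟨hp⟩
  have hq : 1 < p ^ m := Nat.one_lt_pow hm hp.one_lt
  set E := AlgebraicClosure L
  have hLp : CharP L p :=
    (RingHom.charP_iff ((algebraMap A L).comp (algebraMap F A)) (RingHom.injective _) p).1 hFp
  have hEp : CharP E p := (RingHom.charP_iff (algebraMap L E) (RingHom.injective _) p).1 hLp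
  have hAL : Function.Injective (algebraMap A L) := FaithfulSMul.algebraMap_injective A L
  set ι : A →+* E := (algebraMap L E).comp (algebraMap A L) with hι
  have hιinj : Function.Injective ι := (algebraMap L E).injective.comp hAL
  set θL : F[X] →+* L := (algebraMap A L).comp (aeval t : F[X] →ₐ[F] A).toRingHom with hθL
  set θ : F[X] →+* E := (algebraMap L E).comp θL with hθ
  have hθLinj : Function.Injective θL := hAL.comp hinjA
  have hθinj : Function.Injective θ := (algebraMap L E).injective.comp hθLinj
  have hint : ∀ x : E, ∃ y ≠ 0, θ.IsIntegralElem (θ y * x) :=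
    exists_isIntegralElem hθLinj fun y => (hN y).imp fun P hP => ⟨hP.1, hP.2.2⟩
  have hιt : ∀ n ≠ 0, ι t ^ (p ^ m) ^ n ≠ ι t := by
    intro n hn h
    have hqn := Nat.one_lt_pow hn hq
    rw [← map_pow] at h
    refine ht1 ((p ^ m) ^ n - 1) (by omega) (mul_left_cancel₀ ht0 ?_)
    rw [← pow_succ', Nat.sub_add_cancel hqn.le, mul_one]
    exact hιinj h
  have hZ := IsLinearizedAction.finite_setOf_monic hfin hm hιinj hD1 hD hιt
    fun a => Nat.card (A ⧸ Ideal.span {a})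
  set Z : Set (A → E[X]) := {ρ | IsLinearizedAction (p ^ m) ι ρ ∧ (ρ t).Monic ∧
    (ρ t).natDegree = D ∧ ∀ a, (ρ a).natDegree ≤ Nat.card (A ⧸ Ideal.span {a})} with hZdef
  set Z' : Set (A → E[X]) :=
    {ρ | ρ ∈ Z ∧ ∀ c : F, ρ (algebraMap F A c) = C (ι (algebraMap F A c)) * X} with hZ'
  have hZ'fin : Z'.Finite := hZ.subset fun ρ hρ => hρ.1
  -- An element of `E` whose `(D - 1)`-st power lies in `L` has degree at most `N * (D - 1)` over
  -- `F(t)`.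
  let S : (A → E[X]) → Set F[X] := fun ρ => {f | f.Monic ∧ Irreducible f ∧ ∃ x ≠ 0,
    (ρ (aeval t f)).eval x = 0 ∧ ∀ g : F[X], ∃ P : F[X][X], P ≠ 0 ∧ P.natDegree ≤ N * (D - 1) ∧
      P.eval₂ θ ((ρ (aeval t g)).eval x) = 0}
  have hS : ∀ ρ ∈ Z', (S ρ).Finite := fun ρ hρ =>
    hρ.1.1.finite_setOf_irreducible hq hρ.2 hρ.1.2.1 (by rw [hρ.1.2.2.1]; exact hD1) hθinj
      (fun g => rfl) hint _
  let T : Set ((A → E[X]) × E) := ⋃ ρ ∈ Z', ⋃ f ∈ S ρ, {ρ} ×ˢ {x | (ρ (aeval t f)).IsRoot x}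
  have hT : T.Finite := hZ'fin.biUnion fun ρ hρ => (hS ρ hρ).biUnion fun f hf =>
    (Set.finite_singleton ρ).prod (finite_setOfPred_isRoot (hρ.1.1.ne_zero fun h0 =>
      hf.2.1.ne_zero (hθinj (h0.trans (map_zero θ).symm))))
  have key : ∀ c : Quotient (isoSetoid F A L), (∃ φ : DrinfeldModule F A L,
      Quotient.mk _ φ = c ∧ φ.HasRank 1 ∧ φ.torsion ≠ {0}) → ∃ z ∈ T,
      ∃ φ : DrinfeldModule F A L, Quotient.mk _ φ = c ∧ ∃ (u : Eˣ) (x : L), x ≠ 0 ∧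
        z = (fun a => C (↑u⁻¹ : E) * ((φ.poly a).map (algebraMap L E)).comp (C (u : E) * X),
          ↑u⁻¹ * algebraMap L E x) := by
    rintro c ⟨φ, hφc, hφ, hφt⟩
    have hact : IsLinearizedAction (p ^ m) (algebraMap A L) φ.poly :=
      hcard ▸ φ.isLinearizedAction
    obtain ⟨x, ⟨a, ha0, hx⟩, hx0⟩ := φ.exists_ne_zero_of_torsion_ne hφt
    -- `F[X]` is infinite and `A/aA` finite, so every nonzero `a` divides a nonzero polynomial in
    -- `t`.
    obtain ⟨f, hf0, hf⟩ : ∃ f : F[X], f ≠ 0 ∧ a ∣ aeval t f := by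
      have := hfin (Ideal.span {a}) (by simpa using ha0)
      have hni := not_injective_infinite_finite fun f : F[X] =>
        Ideal.Quotient.mk (Ideal.span {a}) (aeval t f)
      simp only [Function.Injective, not_forall] at hni
      obtain ⟨f, g, hfg, hne⟩ := hni
      refine ⟨f - g, sub_ne_zero.2 hne, ?_⟩
      rw [map_sub, ← Ideal.mem_span_singleton, ← Ideal.Quotient.eq]
      exact hfg
    have hfx : (φ.poly (aeval t f)).eval x = 0 := by
      obtain ⟨b, hb⟩ := hf
      rw [hb, mul_comm, hact.eval_mul, hx, hact.eval_zero hq]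
    obtain ⟨g, hg, hgirr, y, hy0, hy⟩ := hact.exists_irreducible hq t hf0 hx0 hfx
    have hdeg : (φ.poly t).natDegree = D := by
      rw [hφ t ht0, pow_one]
      simpa using hD 1
    set l := (φ.poly t).leadingCoeff with hl
    have hl0 : l ≠ 0 := leadingCoeff_ne_zero.2 fun h0 => by rw [h0, natDegree_zero] at hdeg; omega
    have hlE : algebraMap L E l ≠ 0 := by simpa using hl0
    -- This exponent makes the leading coefficient `l * u₀ ^ (D - 1)` of the rescaled `φ_t` equal to
    -- `1`.
    obtain ⟨u₀, hu₀⟩ := IsAlgClosed.exists_pow_nat_eq (algebraMap L E l)⁻¹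
      (by omega : 0 < D - 1)
    have hu0 : u₀ ≠ 0 := by
      rintro rfl
      rw [zero_pow (by omega)] at hu₀
      exact inv_ne_zero hlE hu₀.symm
    set u : Eˣ := Units.mk0 u₀ hu0 with hu
    have hmap : IsLinearizedAction (p ^ m) ι fun a => (φ.poly a).map (algebraMap L E) :=
      hact.map (algebraMap L E)
    have hρ := hmap.scale u
    set ρ : A → E[X] :=
      fun a => C (↑u⁻¹ : E) * ((φ.poly a).map (algebraMap L E)).comp (C (u : E) * X) with hρdef
    have hnd : ∀ a, (ρ a).natDegree ≤ (φ.poly a).natDegree := by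
      intro a
      refine natDegree_le_iff_coeff_eq_zero.2 fun n hn => ?_
      simp only [hρdef]
      rw [IsLinearizedAction.coeff_scale, coeff_map, coeff_eq_zero_of_natDegree_lt hn, map_zero,
        zero_mul, mul_zero]
    have hco : (ρ t).coeff D = 1 := by
      simp only [hρdef]
      rw [IsLinearizedAction.coeff_scale, coeff_map, ← hdeg, coeff_natDegree, hdeg, ← hl,
        Units.val_inv_eq_inv_val, hu, Units.val_mk0]
      have : u₀ ^ D = u₀ ^ (D - 1) * u₀ := by rw [← pow_succ, Nat.sub_add_cancel hD1.le]
      rw [this, hu₀, mul_inv_cancel_left₀ hlE, inv_mul_cancel₀ hu0]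
    have hρm : (ρ t).Monic := monic_of_natDegree_le_of_coeff_eq_one D ((hnd t).trans hdeg.le) hco
    have hρd : (ρ t).natDegree = D := le_antisymm ((hnd t).trans hdeg.le)
      (le_natDegree_of_ne_zero (by rw [hco]; exact one_ne_zero))
    have hρZ : ρ ∈ Z' := by
      refine ⟨⟨hρ, hρm, hρd, fun a => ?_⟩, fun c => ?_⟩
      · rcases eq_or_ne a 0 with rfl | ha
        · rw [hρ.zero, natDegree_zero]
          exact Nat.zero_le _
        · exact (hnd a).trans (by rw [hφ a ha, pow_one])
      · simp only [hρdef]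
        rw [φ.poly_algebraMap, Polynomial.map_mul, map_C, map_X, mul_comp, C_comp, X_comp,
          mul_left_comm, ← mul_assoc (C (↑u⁻¹ : E)), ← C_mul, Units.inv_mul, C_1, one_mul]
        rfl
    have hev : ∀ (a : A) (z : L), (ρ a).eval (↑u⁻¹ * algebraMap L E z) =
        ↑u⁻¹ * algebraMap L E ((φ.poly a).eval z) := by
      intro a z
      simp only [hρdef, Polynomial.eval_mul, eval_C, eval_comp, eval_X]
      rw [Units.mul_inv_cancel_left, eval_map_algebraMap, aeval_algebraMap_apply, coe_aeval_eq_eval]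
    have hroot : (ρ (aeval t g)).eval (↑u⁻¹ * algebraMap L E y) = 0 := by
      rw [hev, hy, map_zero, mul_zero]
    refine ⟨(ρ, ↑u⁻¹ * algebraMap L E y), ?_, φ, hφc, u, y, hy0, rfl⟩
    simp only [T, Set.mem_iUnion]
    refine ⟨ρ, hρZ, g, ⟨hg, hgirr, _, mul_ne_zero u⁻¹.ne_zero (by simpa using hy0), hroot,
      fun b => ?_⟩, rfl, hroot⟩
    -- The `(D - 1)`-st power of the rescaled multiple of `y` is this element of `L`; substituting
    -- `X ^ (D - 1)` in its equation gives one for the multiple itself.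
    obtain ⟨P, hP0, hPN, hP⟩ := hN (l * (φ.poly (aeval t b)).eval y ^ (D - 1))
    refine ⟨expand F[X] (D - 1) P, (expand_ne_zero (by omega)).2 hP0, ?_, ?_⟩
    · rw [natDegree_expand]
      exact Nat.mul_le_mul_right _ hPN
    · have h1 : (↑u⁻¹ * algebraMap L E ((φ.poly (aeval t b)).eval y)) ^ (D - 1) =
          algebraMap L E (l * (φ.poly (aeval t b)).eval y ^ (D - 1)) := by
        rw [mul_pow, map_mul, map_pow, Units.val_inv_eq_inv_val, hu, Units.val_mk0, inv_pow, hu₀,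
          inv_inv]
      rw [hev, expand_eq_comp_X_pow, eval₂_comp, eval₂_pow, eval₂_X, h1, hθ, ← hom_eval₂, hP,
        map_zero]
  choose! z hzT hz using key
  refine Set.Finite.of_injOn (f := z) (fun c hc => hzT c hc) ?_ hT
  intro c hc c' hc' hcc
  obtain ⟨φ, rfl, u, x, hx0, h⟩ := hz c hc
  obtain ⟨φ', rfl, u', x', hx0', h'⟩ := hz c' hc'
  rw [hcc, h', Prod.mk.injEq] at h
  -- Equal second components give `u' / u = x' / x`, so the isomorphism between the two modules is
  -- defined over `L`.
  refine Quotient.sound (isIso_of_scale_eq (w := x' / x) (div_ne_zero hx0' hx0) ?_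
    fun a => (congrFun h.1 a).symm)
  have h2 := h.2
  have hxE : algebraMap L E x ≠ 0 := by simpa using hx0
  have hu := u.ne_zero
  have hu' := u'.ne_zero
  rw [Units.val_inv_eq_inv_val, Units.val_inv_eq_inv_val, inv_mul_eq_div, inv_mul_eq_div,
    div_eq_div_iff hu' hu] at h2
  rw [map_div₀, div_mul_eq_mul_div, div_eq_iff hxE, h2, mul_comm]

end DrinfeldModule

end

theorem mainTheorem2 {F K L : Type*} [Field F] [Finite F] [Field K] [Algebra F K]
    [Algebra (RatFunc F) K] [IsScalarTower F (RatFunc F) K] [FunctionField F K]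
    (P : FunctionFieldPlace F K)
    [Field L] [Algebra K L] [FiniteDimensional K L] :
    {c : Quotient (DrinfeldModule.isoSetoid F P.regularAway L) |
      ∃ φ : DrinfeldModule F P.regularAway L,
        Quotient.mk _ φ = c ∧ φ.HasRank 1 ∧ φ.torsion ≠ {0}}.Finite := by
  -- A single rank 1 module already shows that `A` has finite quotients, hence is Dedekind, and that
  -- `#(A/tⁿ) = D ^ n`, because degrees multiply under composition. Without one there is nothing to
  -- prove.
  rcases Set.eq_empty_or_nonempty {c : Quotient (DrinfeldModule.isoSetoid F P.regularAway L) |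
      ∃ φ : DrinfeldModule F P.regularAway L,
        Quotient.mk _ φ = c ∧ φ.HasRank 1 ∧ φ.torsion ≠ {0}} with h | ⟨-, φ, -, hφ, -⟩
  · rw [h]
    exact Set.finite_empty
  have : FaithfulSMul P.regularAway L := by
    rw [faithfulSMul_iff_algebraMap_injective]
    exact (algebraMap K L).injective.comp Subtype.val_injective
  have hfin : ∀ I : Ideal P.regularAway, I ≠ ⊥ → Finite (P.regularAway ⧸ I) :=
    fun I hI => hφ.finite_quotient hI
  have := P.isDedekindDomain hfin
  obtain ⟨t, ht⟩ := φ.exists_one_lt_natDegree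
  have ht0 : t ≠ 0 := by
    rintro rfl
    rw [φ.isLinearizedAction.zero, natDegree_zero] at ht
    omega
  have hD := hφ.card_quotient_pow ht0
  have htr : Transcendental F t :=
    transcendental_of_pow_ne_one ht0 fun n hn => Ideal.pow_ne_one_of_card_quotient ht hD hn
  have htrK : Transcendental F (t : K) :=
    (transcendental_algebraMap_iff (A := K) (Subtype.val_injective (p := (· ∈ P.regularAway)))).2 htr
  obtain ⟨N, hN⟩ := FunctionField.exists_natDegree_le (L := L) htrK
  refine DrinfeldModule.finite_setOf_torsion_ne hfin ht0 ht hD (N := N) fun y => ?_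
  obtain ⟨Q, hQ0, hQN, hQ⟩ := hN y
  refine ⟨Q, hQ0, hQN, ?_⟩
  convert hQ using 2
  ext g
  · simp
    rfl
  · simp
    rfl
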